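/- **Setting.** Let $G,K$ be groups. Consider a translation-invariant matrix product density operator (MPDO) on periodic chains of every length $L$, $\rho_L=\sum_{i,j}\operatorname{tr}(A^{i_1j_1}\cdots A^{i_Lj_L})\,|i_1\dots i_L\rangle\langle j_1\dots j_L|$, with $\chi\times\chi$ matrices $A^{ij}$, $1\le i,j\le d$, and $\rho_L\ge 0$ for all $L$; write $\langle O\rangle=\operatorname{tr}(\rho_LO)/\operatorname{tr}\rho_L$. It is *strong injective*: $X\mapsto(\sum_{a,b}A^{ij}_{ab}X_{ab})_{ij}$ is injective on $\chi\times\chi$ matrices, and $T=\sum_iA^{ii}$ has a unique largest eigenvalue, i.e. a real, algebraically simple eigenvalue $\lambda$ with $|\mu|<\lambda$ for every other eigenvalue $\mu$. Let $U,W$ be commuting unitary representations of $G,K$ on $\mathbb C^d$. Assume $G$ is a strong symmetry ($U_g^{\otimes L}\rho_L=e^{i\theta}\rho_L$ and $\rho_L(U_g^{\otimes L})^\dagger=e^{-i\theta}\rho_L$ with a phase $\theta=\theta_{g,L}$) and $K$ is a weak symmetry ($W_k^{\otimes L}\rho_L(W_k^{\otimes L})^\dagger=\rho_L$). The doubled state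 has the symmetry $\mathbb G=(G_l\times G_r\times K)\rtimes\mathbb Z_2^{\mathbb H}$, where $(g,h,k)$ acts on the tensor by $U_gW_k$ on the ket index $i$ and by $\overline{U_hW_k}$ on the bra index $j$, and the anti-unitary $\mathbb H$ acts by $A^{ij}\mapsto\overline{A^{ji}}$ and exchanges $G_l$ and $G_r$. A *virtual representation* is a family of invertible matrices $V_x$ with $x\cdot A^{ij}=\kappa(x)V_x^{-1}A^{ij}V_x$, $|\kappa(x)|=1$, and $V_x\,{}^xV_y=\omega(x,y)V_{xy}$ with $\omega(x,y)\in U(1)$, where ${}^x$ is complex conjugation if $x$ is anti-unitary and trivial otherwise. The SPT phase is the class of $\omega$ in $H^2(\mathbb G,U_T(1))$, where anti-unitary elements act on $U(1)$ by conjugation. For $g\in G$ and $p=(s,k)\in G\times K$ put $i_g\omega(p)=\omega(p,g)/\omega(g,p)$, with $g$ read as $(g,e,e)$ and $p$ as $(s,e,k)$ in $\mathbb G$. For $g\in G$ and operators $R',R$ on one site let $\mathcal O(x_1,x_2)=R'(x_1)\big(\prod_{x_1<x<x_2}U_g(x)\big)R(x_2)$. For a subgroup $G'\le G\times K$ and a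 character $e^{i\alpha}:G'\to U(1)$, $R$ *has charge $\alpha$* if $u_pR\,u_p^\dagger=e^{i\alpha(p)}R$ for all $p=(s,k)\in G'$, where $u_p=U_sW_k$. *String order $(g,\alpha)$ is present* if for some $R'=R_{\alpha^*}$ of charge $-\alpha$ and some $R=R_\alpha$ of charge $\alpha$ there is $c>0$ with $|\langle\mathcal O(x_1,x_2)\rangle|\to c$ as $x_2-x_1\to\infty$ and $L-(x_2-x_1)\to\infty$. It *vanishes* if for all such $R',R$ this limit is $0$. **Theorem.** A virtual representation $(V,\omega)$ exists. For every virtual representation: 1. Let $G_1\le G$ and $G'\le G\times K$ be subgroups such that $gs=sg$ for all $g\in G_1$ and $(s,k)\in G'$. Then $i_g\omega(p)$ is multiplicative in $g\in G_1$ and in $p\in G'$. For every $g\in G_1$ (whether or not $i_g\omega$ is trivial on $G'$) and every character $e^{i\alpha}$ of $G'$, string order $(g,\alpha)$ is present if $e^{-i\alpha(\cdot)}=i_g\omega(\cdot)$ on $G'$, and it vanishes otherwise. 2. (Strong Abelian symmetry.) If $G$ is Abelian, the conclusions of 1 hold with $G_1=G'=G$. Moreover, with only the strong Abelian symmetry $G$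 ($K$ trivial), two such MPDOs (with possibly different $d,\chi,A,U$) are in the same SPT phase, i.e. have the same class in $H^2(\mathbb G,U_T(1))$, if and only if string order is present in both for the same pairs $(g,\alpha)$, where $g\in G$ and $e^{i\alpha}$ is a character of $G$. 3. (Strong $G$, weak $K$, arbitrary groups.) The conclusions of 1 hold with $G_1=G$ and $G'=K$; in particular $g\mapsto i_g\omega|_K$ is an element of $\operatorname{Hom}(G,\operatorname{Hom}(K,U(1)))=H^1(G,H^1(K,U(1)))$. Two such MPDOs have the same element of this group if and only if string order is present in both for the same pairs $(g,\alpha)$, where $g\in G$ and $e^{i\alpha}$ is a character of $K$. If moreover their cocycles $\omega_L(g,h)=\omega((g,e,e),(h,e,e))$ have the same class in $H^2(G,U(1))$, this holds if and only if they have the same class in $H^2(\mathbb G,U_T(1))$. -/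

import Mathlib

open scoped Matrix BigOperators ComplexOrder

noncomputable section

namespace MixedSPT

/-- A local MPDO tensor: `A i j` is a `χ × χ` matrix, `i` the ket index and `j` the bra index. -/
abbrev Tensor (d χ : ℕ) : Type := Fin d → Fin d → Matrix (Fin χ) (Fin χ) ℂ

/-- Many-body operators on a chain of `L` sites with local dimension `d`. -/
abbrev ChainOp (d L : ℕ) : Type := Matrix (Fin L → Fin d) (Fin L → Fin d) ℂ

/-- The (unnormalized) matrix product density operator on a periodic chain of `L` sites:
`ρ_L = ∑_{i,j} tr (A^{i_1 j_1} ⋯ A^{i_L j_L}) |i⟩⟨j|`. -/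
def mpdo {d χ : ℕ} (A : Tensor d χ) (L : ℕ) : ChainOp d L :=
  Matrix.of fun i j => ((List.ofFn fun x => A (i x) (j x)).prod).trace

/-- The tensor product `⨂ₓ O x` of on-site operators. -/
def siteProd {d L : ℕ} (O : Fin L → Matrix (Fin d) (Fin d) ℂ) : ChainOp d L :=
  Matrix.of fun i j => ∏ x, O x (i x) (j x)

/-- The global on-site action `⨂ₓ u` of a single-site unitary `u`. -/
def globalOp {d : ℕ} (u : Matrix.unitaryGroup (Fin d) ℂ) (L : ℕ) : ChainOp d L :=
  siteProd fun _ => (u : Matrix (Fin d) (Fin d) ℂ)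

/-- The transfer matrix `T = ∑ᵢ A^{ii}`. -/
def transfer {d χ : ℕ} (A : Tensor d χ) : Matrix (Fin χ) (Fin χ) ℂ := ∑ i, A i i

/-- Strong injectivity: the tensor is injective as a map from the virtual space to the doubled
physical space, and the transfer matrix has a unique largest eigenvalue, which is real:
it is an algebraically simple root of the characteristic polynomial and strictly exceeds the
modulus of every other root. -/
structure StrongInjective {d χ : ℕ} (A : Tensor d χ) : Prop where
  injective : Function.Injective
    fun (X : Matrix (Fin χ) (Fin χ) ℂ) (i j : Fin d) => ∑ a, ∑ b, A i j a b * X a b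
  gap : ∃ l : ℝ, (transfer A).charpoly.rootMultiplicity (l : ℂ) = 1 ∧
    ∀ m : ℂ, (transfer A).charpoly.IsRoot m → m ≠ (l : ℂ) → ‖m‖ < l

/-- Strong symmetry: `U_g ρ = e^{iθ} ρ` and `ρ U_g† = e^{-iθ} ρ` for every chain length. -/
def StronglySymmetric {d χ : ℕ} (A : Tensor d χ) {G : Type*} [Group G]
    (U : G →* Matrix.unitaryGroup (Fin d) ℂ) : Prop :=
  ∀ (L : ℕ) (g : G), ∃ c : Circle,
    globalOp (U g) L * mpdo A L = (c : ℂ) • mpdo A L ∧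
    mpdo A L * (globalOp (U g) L)ᴴ = ((c⁻¹ : Circle) : ℂ) • mpdo A L

/-- Weak symmetry: `W_k ρ W_k† = ρ` for every chain length. -/
def WeaklySymmetric {d χ : ℕ} (A : Tensor d χ) {K : Type*} [Group K]
    (W : K →* Matrix.unitaryGroup (Fin d) ℂ) : Prop :=
  ∀ (L : ℕ) (k : K), globalOp (W k) L * mpdo A L * (globalOp (W k) L)ᴴ = mpdo A L

/-- A translation-invariant strong injective MPDO with an on-site unitary symmetry `G × K`,
where `G` is a strong and `K` a weak symmetry. -/
structure SymmetricMPDO (G K : Type*) [Group G] [Group K] where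
  d : ℕ
  χ : ℕ
  A : Tensor d χ
  posSemidef : ∀ L, (mpdo A L).PosSemidef
  strongInjective : StrongInjective A
  U : G →* Matrix.unitaryGroup (Fin d) ℂ
  W : K →* Matrix.unitaryGroup (Fin d) ℂ
  commute : ∀ g k, Commute (U g) (W k)
  strong : StronglySymmetric A U
  weak : WeaklySymmetric A W

/-- The on-site representation `(g, k) ↦ U_g W_k` of the physical symmetry `G × K`. -/
def SymmetricMPDO.onSite {G K : Type*} [Group G] [Group K] (ρ : SymmetricMPDO G K) :
    G × K →* Matrix.unitaryGroup (Fin ρ.d) ℂ :=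
  ρ.U.noncommCoprod ρ.W ρ.commute

/-! ### The symmetry group of the doubled state -/

/-- The Hermiticity symmetry exchanges the left and the right copy of `G` and fixes `K`. -/
def swapAut (G K : Type*) [Group G] [Group K] : MulAut (G × G × K) where
  toFun p := (p.2.1, p.1, p.2.2)
  invFun p := (p.2.1, p.1, p.2.2)
  left_inv _ := rfl
  right_inv _ := rfl
  map_mul' _ _ := rfl

theorem swapAut_mul_self (G K : Type*) [Group G] [Group K] :
    swapAut G K * swapAut G K = 1 := rfl

/-- The action of `ℤ₂ = {1, -1}`, generated by the Hermiticity symmetry, on `G × G × K`. -/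
def hermAction (G K : Type*) [Group G] [Group K] : ℤˣ →* MulAut (G × G × K) where
  toFun s := if s = 1 then 1 else swapAut G K
  map_one' := by simp
  map_mul' s t := by
    rcases Int.units_eq_one_or s with rfl | rfl <;> rcases Int.units_eq_one_or t with rfl | rfl <;>
      simp [swapAut_mul_self]

/-- The symmetry group `(G_l × G_r × K) ⋊ ℤ₂` of the doubled state. -/
abbrev DoubledGroup (G K : Type*) [Group G] [Group K] : Type _ :=
  SemidirectProduct (G × G × K) ℤˣ (hermAction G K)

/-- `1` on unitary and `-1` on anti-unitary elements. -/
abbrev antiSign (G K : Type*) [Group G] [Group K] : DoubledGroup G K →* ℤˣ :=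
  SemidirectProduct.rightHom

/-- The element `(g, e, k)` of the doubled group: `g` acts on the ket space only, and `k` is the
weak symmetry, acting on both spaces. -/
def ketElt {G K : Type*} [Group G] [Group K] (p : G × K) : DoubledGroup G K :=
  SemidirectProduct.inl (p.1, 1, p.2)

/-- The Hermiticity symmetry on tensors: `A^{ij} ↦ (A^{ji})^*` (entrywise conjugation). -/
def hermTensor {d χ : ℕ} (A : Tensor d χ) : Tensor d χ :=
  fun i j => (A j i).map (starRingEnd ℂ)

/-- The action of the doubled group on the local tensor: `(g, h, k)` acts on the ket index by
`U_g W_k` and on the bra index by the complex conjugate of `U_h W_k`, after the Hermiticity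
symmetry in case of an anti-unitary element. -/
def SymmetricMPDO.act {G K : Type*} [Group G] [Group K] (ρ : SymmetricMPDO G K)
    (x : DoubledGroup G K) : Tensor ρ.d ρ.χ := fun i j =>
  ∑ i', ∑ j',
    ((ρ.onSite (x.left.1, x.left.2.2) : Matrix (Fin ρ.d) (Fin ρ.d) ℂ) i i' *
      starRingEnd ℂ
        ((ρ.onSite (x.left.2.1, x.left.2.2) : Matrix (Fin ρ.d) (Fin ρ.d) ℂ) j j')) •
      (if antiSign G K x = 1 then ρ.A i' j' else hermTensor ρ.A i' j')

/-- `ᵍV`: complex conjugation of an invertible virtual matrix for an anti-unitary element. -/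
def twist {G K : Type*} [Group G] [Group K] {χ : ℕ} (x : DoubledGroup G K)
    (V : GL (Fin χ) ℂ) : GL (Fin χ) ℂ :=
  if antiSign G K x = 1 then V else Matrix.GeneralLinearGroup.map (starRingEnd ℂ) V

/-- `V` is the projective representation on the virtual space by which the symmetry of the doubled
state acts on the local tensor, `g · A = κ(g) V_g⁻¹ A V_g` with a phase `κ(g)`, and `ω` is its
`U(1)`-valued 2-cocycle, `V_g ᵍV_h = ω(g,h) V_{gh}`. -/
structure SymmetricMPDO.IsProjectiveAction {G K : Type*} [Group G] [Group K]
    (ρ : SymmetricMPDO G K) (V : DoubledGroup G K → GL (Fin ρ.χ) ℂ)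
    (ω : DoubledGroup G K → DoubledGroup G K → Circle) : Prop where
  gauge : ∃ κ : DoubledGroup G K → Circle, ∀ x i j,
    ρ.act x i j = (κ x : ℂ) • (((V x)⁻¹ : GL (Fin ρ.χ) ℂ).val * ρ.A i j * (V x).val)
  projective : ∀ x y, (V x * twist x (V y)).val = (ω x y : ℂ) • (V (x * y)).val

/-- Two `U(1)`-valued 2-cocycles of `Γ` differ by a coboundary, i.e. define the same class in
`H²(Γ, U_T(1))`, where `x` acts on `U(1)` by complex conjugation if `σ x = -1`. -/
def Cohomologous {Γ : Type*} [Group Γ] (σ : Γ →* ℤˣ) (ω₁ ω₂ : Γ → Γ → Circle) : Prop :=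
  ∃ φ : Γ → Circle, ∀ x y,
    ω₂ x y = ω₁ x y * (φ (x * y) / (φ x * φ y ^ ((σ x : ℤˣ) : ℤ)))

/-- The slant product `i_g ω(g') = ω(g', g) / ω(g, g')`. -/
def slant {Γ : Type*} (ω : Γ → Γ → Circle) (g g' : Γ) : Circle := ω g' g / ω g g'

/-- The cocycle of the left symmetry, `ω_L(g, h) = ω(g^l, h^l)`. -/
def ketCocycle {G K : Type*} [Group G] [Group K]
    (ω : DoubledGroup G K → DoubledGroup G K → Circle) (g h : G) : Circle :=
  ω (ketElt (g, 1)) (ketElt (h, 1))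

/-! ### String order -/

/-- The string operator `R'(x₁) (∏_{x₁ < x < x₂} u(x)) R(x₂)` on a chain of `L` sites. -/
def stringOp {d L : ℕ} (u R' R : Matrix (Fin d) (Fin d) ℂ) (x₁ x₂ : Fin L) : ChainOp d L :=
  siteProd fun x =>
    if x = x₁ then R' else if x = x₂ then R else if x₁ < x ∧ x < x₂ then u else 1

/-- The expectation value `tr (ρ_L O) / tr ρ_L`. -/
def expect {d χ : ℕ} (A : Tensor d χ) {L : ℕ} (O : ChainOp d L) : ℂ :=
  (mpdo A L * O).trace / (mpdo A L).trace

/-- The modulus of the expectation value of the string operator converges to `c` when both arcs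
between the end points of the string on the periodic chain become long. -/
def StringLimit {d χ : ℕ} (A : Tensor d χ) (u R' R : Matrix (Fin d) (Fin d) ℂ) (c : ℝ) : Prop :=
  ∀ ε > 0, ∃ N : ℕ, ∀ (L : ℕ) (x₁ x₂ : Fin L),
    (x₁ : ℕ) + N ≤ x₂ → (x₂ : ℕ) + N ≤ L + x₁ → |‖expect A (stringOp u R' R x₁ x₂)‖ - c| < ε

/-- `R` carries the charge `α` of the group `H` acting on a site by `u`:
`u_h R u_h† = α(h) R`. -/
def Carries {d : ℕ} {H : Type*} [Group H] (u : H →* Matrix.unitaryGroup (Fin d) ℂ)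
    (α : H →* Circle) (R : Matrix (Fin d) (Fin d) ℂ) : Prop :=
  ∀ h, (u h : Matrix (Fin d) (Fin d) ℂ) * R * (u h : Matrix (Fin d) (Fin d) ℂ)ᴴ = (α h : ℂ) • R

/-- Some string operator with string `U_g`, `g` in the strong symmetry group, and with end operators
of charges `α*` and `α` under `u` has a non-decaying expectation value. -/
def SymmetricMPDO.HasStringOrder {G K : Type*} [Group G] [Group K] (ρ : SymmetricMPDO G K)
    {H : Type*} [Group H] (u : H →* Matrix.unitaryGroup (Fin ρ.d) ℂ) (g : G)
    (α : H →* Circle) : Prop :=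
  ∃ R' R : Matrix (Fin ρ.d) (Fin ρ.d) ℂ, Carries u α⁻¹ R' ∧ Carries u α R ∧
    ∃ c : ℝ, 0 < c ∧ StringLimit ρ.A (ρ.U g).val R' R c

/-- Every string operator with string `U_g` and with end operators of charges `α*` and `α` under `u`
has an expectation value that vanishes in the limit of a long string. -/
def SymmetricMPDO.StringOrderVanishes {G K : Type*} [Group G] [Group K] (ρ : SymmetricMPDO G K)
    {H : Type*} [Group H] (u : H →* Matrix.unitaryGroup (Fin ρ.d) ℂ) (g : G)
    (α : H →* Circle) : Prop :=
  ∀ R' R : Matrix (Fin ρ.d) (Fin ρ.d) ℂ, Carries u α⁻¹ R' → Carries u α R →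
    StringLimit ρ.A (ρ.U g).val R' R 0

end MixedSPT

end

/-!
A symmetry that preserves the MPDO for every chain length acts on the injective tensor by a gauge
transformation whose matrix is unique up to a scalar; this yields `(V, ω)`. As the transfer matrix
has a dominant eigenvalue, with right and left eigenvectors `r` and `s`, a long string expectation
value factorizes into contributions of the two end points, and the one at `R` is
`s ⬝ᵥ (V_g * opTransfer R) *ᵥ r`. For `p = (h, k)` the matrix `V_p` of the diagonal element
`(h, h, k)` fixes `r` and `s` up to scalars, so moving it past `R` and `V_g` forces this number to
vanish unless the charge of `R` cancels the slant product. If it does, injectivity provides an `R`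
whose transfer matrix is `V_g⁻¹`, and this `R` has the right charge.

Everything else rests on positivity. The string values with end points `Rᴴ` and `R` are entries of a
Gram matrix of half-infinite strings, so their limit is nonnegative, and therefore `ℍ V_g ℍ V_g r`
is a positive multiple of `r` once `ℍ` is normalized to fix `r`. The commutator of the ket and the
bra copy of `G` is a phase which this positivity turns into `1`. Rescaling the representation by its
eigenvalues on `r` then brings `ω` into a normal form that involves only its restriction to the ket
copy of `G` and the pairing of `G` with `K`. For abelian `G`, two cocycles with the same slant
product differ by a symmetric cocycle, which is a coboundary since `U(1)` is divisible.
-/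

open Filter Topology

namespace MixedSPT

section PowersTendstoZero

theorem tendsto_pow_zero_of_spectralRadius_lt_one {R : Type*} [NormedRing R] [NormedAlgebra ℂ R]
    [CompleteSpace R] {a : R} (h : spectralRadius ℂ a < 1) :
    Tendsto (fun k : ℕ => a ^ k) atTop (𝓝 0) := by
  obtain ⟨c, hc, hc_one⟩ := ENNReal.lt_iff_exists_nnreal_btwn.1 h
  have hgeom : Tendsto (fun k : ℕ => (c : ℝ) ^ k) atTop (𝓝 0) :=
    tendsto_pow_atTop_nhds_zero_of_lt_one c.2 (by exact_mod_cast hc_one)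
  refine squeeze_zero_norm' ?_ hgeom
  filter_upwards [(spectrum.pow_nnnorm_pow_one_div_tendsto_nhds_spectralRadius a).eventually
    (gt_mem_nhds hc), eventually_ne_atTop 0] with k hk hk0
  have hle : (‖a ^ k‖₊ : ENNReal) ≤ (c : ENNReal) ^ k := by
    rw [← ENNReal.rpow_natCast, ← ENNReal.rpow_inv_le_iff (by positivity)]
    simpa only [one_div] using hk.le
  exact_mod_cast hle

variable {ι : Type*} [Fintype ι] [DecidableEq ι]

attribute [local instance] Matrix.linftyOpNormedRing Matrix.linftyOpNormedAlgebra in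
theorem tendsto_matrix_pow_zero {N : Matrix ι ι ℂ} (h : ∀ z ∈ spectrum ℂ N, ‖z‖ < 1) :
    Tendsto (fun k : ℕ => N ^ k) atTop (𝓝 0) := by
  cases isEmpty_or_nonempty ι
  · exact tendsto_const_nhds.congr fun _ => Subsingleton.elim _ _
  have : CompleteSpace (Matrix ι ι ℂ) := FiniteDimensional.complete ℂ _
  exact tendsto_pow_zero_of_spectralRadius_lt_one
    (spectrum.spectralRadius_lt_of_forall_lt N fun z hz => by exact_mod_cast h z hz)

end PowersTendstoZero

section SimpleEigenvalue

variable {ι F : Type*} [Fintype ι] [DecidableEq ι] [Field F] {T : Matrix ι ι F} {l : F}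

theorem aeval_mulVec_of_mulVec_eq_smul {m : F} {v : ι → F} (h : T *ᵥ v = m • v)
    (q : Polynomial F) : Polynomial.aeval T q *ᵥ v = q.eval m • v := by
  rw [← Matrix.toLinAlgEquiv'_apply, ← AlgEquiv.coe_toAlgHom, ← Polynomial.aeval_algHom_apply]
  exact Module.End.aeval_apply_of_mem_apply_eq_smul h

theorem isRoot_charpoly_of_mulVec_eq_smul {m : F} {v : ι → F} (hv : v ≠ 0)
    (h : T *ᵥ v = m • v) : T.charpoly.IsRoot m := by
  have := aeval_mulVec_of_mulVec_eq_smul h T.charpoly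
  rw [Matrix.aeval_self_charpoly, Matrix.zero_mulVec, eq_comm, smul_eq_zero] at this
  exact this.resolve_right hv

-- If the characteristic polynomial is `(X - l) q` with `q l ≠ 0`, then `P = q T / q l`.
theorem exists_spectralProjection (h : T.charpoly.rootMultiplicity l = 1) :
    ∃ P : Matrix ι ι F, T * P = l • P ∧ P * T = l • P ∧ ∀ v, T *ᵥ v = l • v → P *ᵥ v = v := by
  obtain ⟨q, hq, hndvd⟩ := Polynomial.exists_eq_pow_rootMultiplicity_mul_and_not_dvd T.charpoly
    (Matrix.charpoly_monic T).ne_zero l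
  rw [h, pow_one] at hq
  have hql : q.eval l ≠ 0 := fun h0 => hndvd (Polynomial.dvd_iff_isRoot.2 h0)
  have hTq : T * Polynomial.aeval T q = l • Polynomial.aeval T q := by
    have hcayley := Matrix.aeval_self_charpoly T
    rwa [hq, map_mul, map_sub, Polynomial.aeval_X, Polynomial.aeval_C, sub_mul, sub_eq_zero,
      ← Algebra.smul_def] at hcayley
  have hqT : Polynomial.aeval T q * T = T * Polynomial.aeval T q := by
    simpa only [map_mul, Polynomial.aeval_X] using congrArg (Polynomial.aeval T)
      (mul_comm q Polynomial.X)
  refine ⟨(q.eval l)⁻¹ • Polynomial.aeval T q, ?_, ?_, fun v hv => ?_⟩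
  · rw [mul_smul_comm, hTq, smul_comm]
  · rw [smul_mul_assoc, hqT, hTq, smul_comm]
  · rw [Matrix.smul_mulVec, aeval_mulVec_of_mulVec_eq_smul hv, inv_smul_smul₀ hql]

theorem exists_unique_eigenvector (h : T.charpoly.rootMultiplicity l = 1) :
    ∃ r : ι → F, r ≠ 0 ∧ T *ᵥ r = l • r ∧ ∀ v, T *ᵥ v = l • v → ∃ c : F, c • r = v := by
  have hfinrank := LinearMap.finrank_eigenspace_le (Matrix.toLin' T) l
  rw [Matrix.charpoly_toLin', h] at hfinrank
  have hev : Module.End.HasEigenvalue (Matrix.toLin' T) l := by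
    rw [Module.End.hasEigenvalue_iff_isRoot_charpoly, Matrix.charpoly_toLin',
      ← Polynomial.rootMultiplicity_pos (Matrix.charpoly_monic T).ne_zero, h]
    exact one_pos
  obtain ⟨r, hr⟩ := hev.exists_hasEigenvector
  refine ⟨r, hr.2, hr.apply_eq_smul, fun v hv => ?_⟩
  have hv_mem : v ∈ Module.End.eigenspace (Matrix.toLin' T) l :=
    Module.End.mem_eigenspace_iff.2 hv
  have hne : (⟨r, hr.1⟩ : Module.End.eigenspace (Matrix.toLin' T) l) ≠ 0 :=
    Subtype.coe_ne_coe.1 hr.2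
  obtain ⟨c, hc⟩ := exists_smul_eq_of_finrank_eq_one
    (hfinrank.antisymm (Module.finrank_pos_iff_exists_ne_zero.2 ⟨_, hne⟩)) hne ⟨v, hv_mem⟩
  exact ⟨c, congrArg Subtype.val hc⟩

theorem exists_left_right_eigenvector (h : T.charpoly.rootMultiplicity l = 1) :
    ∃ r s : ι → F, T *ᵥ r = l • r ∧ s ᵥ* T = l • s ∧ s ⬝ᵥ r = 1 ∧
      ∀ v, T *ᵥ v = l • v → v = (s ⬝ᵥ v) • r := by
  obtain ⟨P, hTP, hPT, hP⟩ := exists_spectralProjection h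
  obtain ⟨r, hr0, hr, hr_unique⟩ := exists_unique_eigenvector h
  choose s hs using fun j => hr_unique (P *ᵥ Pi.single j 1)
    (by rw [Matrix.mulVec_mulVec, hTP, Matrix.smul_mulVec])
  have hPrs : P = Matrix.vecMulVec r s := by
    ext i j
    simpa [Matrix.vecMulVec_apply, mul_comm] using (congrFun (hs j) i).symm
  have hP_apply : ∀ v, T *ᵥ v = l • v → v = (s ⬝ᵥ v) • r := fun v hv => by
    simpa [hPrs, Matrix.vecMulVec_mulVec] using (hP v hv).symm
  have hcancel : ∀ v w : ι → F, Matrix.vecMulVec r v = Matrix.vecMulVec r w → v = w := by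
    obtain ⟨i, hi⟩ := Function.ne_iff.1 hr0
    exact fun v w hvw => funext fun j => mul_left_cancel₀ hi (congrFun (congrFun hvw i) j)
  refine ⟨r, s, hr, hcancel _ _ ?_, ?_, hP_apply⟩
  · rw [← Matrix.vecMulVec_mul, ← hPrs, hPT, hPrs, Matrix.vecMulVec_smul]
  · exact smul_left_injective F hr0 (by simpa using (hP_apply r hr).symm)

end SimpleEigenvalue

section Dominant

variable {ι : Type*} [Fintype ι] [DecidableEq ι]

/-- `l > 0` is a dominant eigenvalue of `T` with right and left eigenvectors `r` and `s`: this is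
encoded by the convergence of the powers of `T / l` to the projection `r sᵀ` of rank one. -/
structure Dominant (T : Matrix ι ι ℂ) (l : ℝ) (r s : ι → ℂ) : Prop where
  pos : 0 < l
  dot : s ⬝ᵥ r = 1
  tendsto : Tendsto (fun k : ℕ => ((l : ℂ)⁻¹ • T) ^ k) atTop (𝓝 (Matrix.vecMulVec r s))

theorem add_pow_succ_of_mul_eq_zero {R : Type*} [Semiring R] {a p : R} (hap : a * p = 0)
    (hpa : p * a = 0) (hp : IsIdempotentElem p) (k : ℕ) :
    (a + p) ^ (k + 1) = a ^ (k + 1) + p := by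
  induction k with
  | zero => simp only [zero_add, pow_one]
  | succ k ih =>
    rw [pow_succ, ih, add_mul, mul_add, mul_add, hpa, hp.eq, zero_add, ← pow_succ, pow_succ a k,
      mul_assoc, hap, mul_zero, add_zero]

theorem norm_lt_one_of_mem_spectrum_sub_vecMulVec {T : Matrix ι ι ℂ} {l : ℝ} {r s : ι → ℂ}
    (hl : 0 < l) (hgap : ∀ m : ℂ, T.charpoly.IsRoot m → m ≠ (l : ℂ) → ‖m‖ < l)
    (hs : s ᵥ* T = (l : ℂ) • s) (hdot : s ⬝ᵥ r = 1)
    (hunique : ∀ v, T *ᵥ v = (l : ℂ) • v → v = (s ⬝ᵥ v) • r) {z : ℂ}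
    (hz : z ∈ spectrum ℂ ((l : ℂ)⁻¹ • T - Matrix.vecMulVec r s)) : ‖z‖ < 1 := by
  have hlC : (l : ℂ) ≠ 0 := Complex.ofReal_ne_zero.2 hl.ne'
  obtain rfl | hz0 := eq_or_ne z 0
  · simp
  rw [← Matrix.spectrum_toLin', ← Module.End.hasEigenvalue_iff_mem_spectrum] at hz
  obtain ⟨v, hv⟩ := hz.exists_hasEigenvector
  have hNv : ((l : ℂ)⁻¹ • T - Matrix.vecMulVec r s) *ᵥ v = z • v := hv.apply_eq_smul
  have hsv : s ⬝ᵥ v = 0 := by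
    refine (smul_eq_zero.1 ?_).resolve_left hz0
    rw [← dotProduct_smul, ← hNv, Matrix.dotProduct_mulVec, Matrix.vecMul_sub,
      Matrix.vecMul_smul, hs, inv_smul_smul₀ hlC, Matrix.vecMul_vecMulVec, hdot, one_smul,
      sub_self, zero_dotProduct]
  have hTv : T *ᵥ v = ((l : ℂ) * z) • v := by
    rw [mul_smul, ← hNv, Matrix.sub_mulVec, Matrix.vecMulVec_mulVec, hsv, MulOpposite.op_zero,
      zero_smul, sub_zero, Matrix.smul_mulVec, smul_inv_smul₀ hlC]
  have hne : (l : ℂ) * z ≠ l := fun h => hv.2 <| by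
    rw [h] at hTv
    rw [hunique v hTv, hsv, zero_smul]
  have hlt := hgap _ (isRoot_charpoly_of_mulVec_eq_smul hv.2 hTv) hne
  rw [norm_mul, Complex.norm_of_nonneg hl.le] at hlt
  exact (mul_lt_iff_lt_one_right hl).1 hlt

theorem exists_dominant {T : Matrix ι ι ℂ} {l : ℝ} (hl : 0 < l)
    (hmult : T.charpoly.rootMultiplicity (l : ℂ) = 1)
    (hgap : ∀ m : ℂ, T.charpoly.IsRoot m → m ≠ (l : ℂ) → ‖m‖ < l) :
    ∃ r s, Dominant T l r s := by
  have hlC : (l : ℂ) ≠ 0 := Complex.ofReal_ne_zero.2 hl.ne'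
  obtain ⟨r, s, hr, hs, hdot, hunique⟩ := exists_left_right_eigenvector hmult
  set P := Matrix.vecMulVec r s with hP
  set N := (l : ℂ)⁻¹ • T - P with hN
  have hPP : P * P = P := by rw [hP, Matrix.vecMulVec_mul_vecMulVec, hdot, one_smul]
  have hNP : N * P = 0 := by
    rw [hN, sub_mul, hPP, smul_mul_assoc, hP, Matrix.mul_vecMulVec, hr, Matrix.smul_vecMulVec,
      inv_smul_smul₀ hlC, sub_self]
  have hPN : P * N = 0 := by
    rw [hN, mul_sub, hPP, mul_smul_comm, hP, Matrix.vecMulVec_mul, hs, Matrix.vecMulVec_smul,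
      inv_smul_smul₀ hlC, sub_self]
  have hpow : ∀ k : ℕ, ((l : ℂ)⁻¹ • T) ^ (k + 1) = N ^ (k + 1) + P := fun k => by
    rw [← add_pow_succ_of_mul_eq_zero hNP hPN hPP, hN, sub_add_cancel]
  have hlim : Tendsto (fun k : ℕ => N ^ (k + 1)) atTop (𝓝 0) :=
    (tendsto_matrix_pow_zero fun _ =>
      norm_lt_one_of_mem_spectrum_sub_vecMulVec hl hgap hs hdot hunique).comp
        (tendsto_add_atTop_nat 1)
  refine ⟨r, s, hl, hdot, (tendsto_add_atTop_iff_nat 1).1 ?_⟩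
  simpa only [hpow, zero_add] using hlim.add_const P

end Dominant

section OperatorTransfer

variable {d χ L : ℕ}

theorem prod_ofFn_sum_sum_smul {S R ι κ : Type*} [CommSemiring S] [Semiring R] [Algebra S R]
    [Fintype ι] [Fintype κ] (c : Fin L → ι → κ → S) (f : Fin L → ι → κ → R) :
    (List.ofFn fun x => ∑ i, ∑ j, c x i j • f x i j).prod =
      ∑ i : Fin L → ι, ∑ j : Fin L → κ,
        (∏ x, c x (i x) (j x)) • (List.ofFn fun x => f x (i x) (j x)).prod := by
  simp only [← MultilinearMap.mkPiAlgebraFin_apply (R := S), MultilinearMap.map_sum,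
    MultilinearMap.map_smul_univ]

/-- The transfer matrix `∑ O_{ji} A^{ij}` with an operator `O` inserted on the site. -/
def opTransfer (A : Tensor d χ) :
    Matrix (Fin d) (Fin d) ℂ →ₗ[ℂ] Matrix (Fin χ) (Fin χ) ℂ where
  toFun O := ∑ i, ∑ j, O j i • A i j
  map_add' O O' := by simp only [Matrix.add_apply, add_smul, Finset.sum_add_distrib]
  map_smul' c O := by simp only [Matrix.smul_apply, smul_assoc, Finset.smul_sum, RingHom.id_apply]

theorem opTransfer_apply (A : Tensor d χ) (O : Matrix (Fin d) (Fin d) ℂ) :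
    opTransfer A O = ∑ i, ∑ j, O j i • A i j := rfl

theorem opTransfer_one (A : Tensor d χ) : opTransfer A 1 = transfer A := by
  simp [opTransfer_apply, transfer, Matrix.one_apply]

theorem opTransfer_single (A : Tensor d χ) (i j : Fin d) :
    opTransfer A (Matrix.single j i 1) = A i j := by
  simp [opTransfer_apply, Matrix.single_apply, ite_and]

theorem opTransfer_injective : Function.Injective (opTransfer (d := d) (χ := χ)) :=
  fun A B h => funext₂ fun i j => by rw [← opTransfer_single A, h, opTransfer_single]

theorem siteProd_one : siteProd (fun _ : Fin L => (1 : Matrix (Fin d) (Fin d) ℂ)) = 1 := by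
  ext i j
  simp [siteProd, Matrix.one_apply, Finset.prod_ite_zero, funext_iff]

theorem siteProd_single (i j : Fin L → Fin d) :
    siteProd (fun x => Matrix.single (i x) (j x) (1 : ℂ)) = Matrix.single i j 1 := by
  ext k l
  simp [siteProd, Matrix.single_apply, Finset.prod_ite_zero, funext_iff, forall_and]

theorem siteProd_mul (O O' : Fin L → Matrix (Fin d) (Fin d) ℂ) :
    siteProd O * siteProd O' = siteProd fun x => O x * O' x := by
  ext i j
  simp [siteProd, Matrix.mul_apply, Finset.prod_univ_sum, Finset.prod_mul_distrib]

theorem siteProd_conjTranspose (O : Fin L → Matrix (Fin d) (Fin d) ℂ) :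
    (siteProd O)ᴴ = siteProd fun x => (O x)ᴴ := by
  ext i j
  simp [siteProd, Matrix.conjTranspose_apply]

theorem trace_mpdo_mul_siteProd (A : Tensor d χ) (O : Fin L → Matrix (Fin d) (Fin d) ℂ) :
    (mpdo A L * siteProd O).trace = ((List.ofFn fun x => opTransfer A (O x)).prod).trace := by
  simp only [opTransfer_apply, prod_ofFn_sum_sum_smul fun x i j => O x j i]
  simp only [Matrix.trace_sum, Matrix.trace_smul, smul_eq_mul, mul_comm _ (Matrix.trace _)]
  rfl

theorem trace_mpdo (A : Tensor d χ) (L : ℕ) : (mpdo A L).trace = (transfer A ^ L).trace := by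
  rw [← mul_one (mpdo A L), ← siteProd_one, trace_mpdo_mul_siteProd, opTransfer_one,
    List.ofFn_const, List.prod_replicate]

theorem chainOp_ext {M N : ChainOp d L}
    (h : ∀ O : Fin L → Matrix (Fin d) (Fin d) ℂ,
      (M * siteProd O).trace = (N * siteProd O).trace) : M = N := by
  ext i j
  simpa [siteProd_single, Matrix.trace_mul_single] using
    h fun x => Matrix.single (j x) (i x) 1

end OperatorTransfer

section TensorTransformations

variable {d χ : ℕ}

/-- The tensor with the operator `u` applied to the ket index and the complex conjugate of `v`
applied to the bra index. -/
def leftRight (u v : Matrix (Fin d) (Fin d) ℂ) (A : Tensor d χ) : Tensor d χ :=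
  fun i j => ∑ i', ∑ j', (u i i' * starRingEnd ℂ (v j j')) • A i' j'

/-- The transformation `A^{ij} ↦ c V⁻¹ A^{ij} V` of a tensor by the scalar `c` and the change of
basis `V` of the virtual space. -/
def gaugeTransform (c : ℂ) (V : GL (Fin χ) ℂ) (A : Tensor d χ) : Tensor d χ :=
  fun i j => c • (V⁻¹.val * A i j * V.val)

theorem opTransfer_leftRight (u v O : Matrix (Fin d) (Fin d) ℂ) (A : Tensor d χ) :
    opTransfer (leftRight u v A) O = opTransfer A (vᴴ * O * u) := by
  induction O using Matrix.induction_on' with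
  | h_zero => simp only [mul_zero, zero_mul, map_zero]
  | h_add O O' hO hO' => rw [map_add, hO, hO', mul_add, add_mul, map_add]
  | h_std_basis j i c =>
    have hentry (i' j') : (vᴴ * Matrix.single j i c * u) j' i' =
        c * (u i i' * starRingEnd ℂ (v j j')) := by
      simp [Matrix.mul_apply, Matrix.single_apply, ite_and, mul_comm, mul_left_comm]
    have hsingle : Matrix.single j i c = c • Matrix.single j i 1 := by simp
    rw [hsingle, map_smul, opTransfer_single, ← hsingle]
    simp only [opTransfer_apply, hentry, mul_smul, leftRight, Finset.smul_sum]

theorem opTransfer_gaugeTransform (c : ℂ) (V : GL (Fin χ) ℂ) (A : Tensor d χ)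
    (O : Matrix (Fin d) (Fin d) ℂ) :
    opTransfer (gaugeTransform c V A) O = c • (V⁻¹.val * opTransfer A O * V.val) := by
  simp only [opTransfer_apply, gaugeTransform, Finset.mul_sum, Finset.sum_mul, Finset.smul_sum,
    mul_smul_comm, smul_mul_assoc, smul_comm c]

theorem opTransfer_hermTensor (A : Tensor d χ) (O : Matrix (Fin d) (Fin d) ℂ) :
    opTransfer (hermTensor A) O = (opTransfer A Oᴴ).map (starRingEnd ℂ) := by
  ext a b
  simp only [opTransfer_apply, hermTensor, Matrix.sum_apply, Matrix.smul_apply, Matrix.map_apply,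
    map_sum, Matrix.conjTranspose_apply, smul_eq_mul, map_mul, starRingEnd_apply, star_star]
  exact Finset.sum_comm

theorem leftRight_leftRight (u v u' v' : Matrix (Fin d) (Fin d) ℂ) (A : Tensor d χ) :
    leftRight u v (leftRight u' v' A) = leftRight (u * u') (v * v') A :=
  opTransfer_injective <| LinearMap.ext fun O => by
    simp only [opTransfer_leftRight, Matrix.conjTranspose_mul, mul_assoc]

theorem hermTensor_leftRight (u v : Matrix (Fin d) (Fin d) ℂ) (A : Tensor d χ) :
    hermTensor (leftRight u v A) = leftRight v u (hermTensor A) :=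
  opTransfer_injective <| LinearMap.ext fun O => by
    simp only [opTransfer_leftRight, opTransfer_hermTensor, Matrix.conjTranspose_mul,
      Matrix.conjTranspose_conjTranspose, mul_assoc]

theorem hermTensor_hermTensor (A : Tensor d χ) : hermTensor (hermTensor A) = A := by
  ext i j a b
  simp [hermTensor]

theorem leftRight_gaugeTransform (u v : Matrix (Fin d) (Fin d) ℂ) (c : ℂ) (V : GL (Fin χ) ℂ)
    (A : Tensor d χ) :
    leftRight u v (gaugeTransform c V A) = gaugeTransform c V (leftRight u v A) :=
  opTransfer_injective <| LinearMap.ext fun O => by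
    simp only [opTransfer_leftRight, opTransfer_gaugeTransform]

theorem gaugeTransform_gaugeTransform (c c' : ℂ) (V V' : GL (Fin χ) ℂ) (A : Tensor d χ) :
    gaugeTransform c V (gaugeTransform c' V' A) = gaugeTransform (c * c') (V' * V) A := by
  ext1 i; ext1 j
  simp only [gaugeTransform, mul_inv_rev, Units.val_mul, mul_smul_comm, smul_mul_assoc, smul_smul,
    mul_assoc]

theorem hermTensor_gaugeTransform (c : ℂ) (V : GL (Fin χ) ℂ) (A : Tensor d χ) :
    hermTensor (gaugeTransform c V A) = gaugeTransform (star c)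
      (Matrix.GeneralLinearGroup.map (starRingEnd ℂ) V) (hermTensor A) := by
  ext1 i; ext1 j
  simp only [hermTensor, gaugeTransform, Matrix.map_smul' _ _ _ (map_mul _), Matrix.map_mul,
    ← map_inv]
  rfl

theorem transfer_gaugeTransform (c : ℂ) (V : GL (Fin χ) ℂ) (A : Tensor d χ) :
    transfer (gaugeTransform c V A) = c • (V⁻¹.val * transfer A * V.val) := by
  simp only [← opTransfer_one, opTransfer_gaugeTransform]

theorem mpdo_leftRight (u v : Matrix (Fin d) (Fin d) ℂ) (A : Tensor d χ) (L : ℕ) :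
    mpdo (leftRight u v A) L = siteProd (fun _ => u) * mpdo A L * (siteProd fun _ => v)ᴴ :=
  chainOp_ext fun O => by
    rw [trace_mpdo_mul_siteProd, siteProd_conjTranspose, mul_assoc, mul_assoc,
      Matrix.trace_mul_comm, mul_assoc, mul_assoc, siteProd_mul, siteProd_mul,
      trace_mpdo_mul_siteProd]
    simp only [opTransfer_leftRight, mul_assoc]

theorem mpdo_hermTensor (A : Tensor d χ) (L : ℕ) : mpdo (hermTensor A) L = (mpdo A L)ᴴ := by
  ext i j
  have hmap : (List.ofFn fun x => hermTensor A (i x) (j x)) =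
      (List.ofFn fun x => A (j x) (i x)).map (starRingEnd ℂ).mapMatrix := by
    rw [List.map_ofFn]; rfl
  simp only [mpdo, Matrix.of_apply, Matrix.conjTranspose_apply, hmap, ← map_list_prod]
  simp [Matrix.trace]

end TensorTransformations

section OperatorLift

variable {d χ : ℕ} {A : Tensor d χ}

/-- The adjoint of `opTransfer A` with respect to the Hilbert–Schmidt inner products. -/
def dualOp (A : Tensor d χ) :
    Matrix (Fin χ) (Fin χ) ℂ →ₗ[ℂ] Matrix (Fin d) (Fin d) ℂ where
  toFun Y := Matrix.of fun j i => ((A i j)ᴴ * Y).trace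
  map_add' Y Z := by ext; simp [mul_add]
  map_smul' c Y := by ext; simp

theorem dualOp_apply (A : Tensor d χ) (Y : Matrix (Fin χ) (Fin χ) ℂ) (i j : Fin d) :
    dualOp A Y j i = ((A i j)ᴴ * Y).trace := rfl

theorem trace_conjTranspose_opTransfer_mul (A : Tensor d χ) (O : Matrix (Fin d) (Fin d) ℂ)
    (Y : Matrix (Fin χ) (Fin χ) ℂ) :
    ((opTransfer A O)ᴴ * Y).trace = (Oᴴ * dualOp A Y).trace := by
  simp only [opTransfer_apply, Matrix.conjTranspose_sum, Matrix.conjTranspose_smul, Finset.sum_mul,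
    Matrix.trace_sum, smul_mul_assoc, Matrix.trace_smul, ← dualOp_apply]
  rfl

theorem dualOp_leftRight (u v : Matrix (Fin d) (Fin d) ℂ) (A : Tensor d χ)
    (Y : Matrix (Fin χ) (Fin χ) ℂ) : dualOp (leftRight u v A) Y = v * dualOp A Y * uᴴ := by
  refine Matrix.ext_iff_trace_mul_left.2 fun O => ?_
  rw [← Matrix.conjTranspose_conjTranspose O, ← trace_conjTranspose_opTransfer_mul,
    opTransfer_leftRight, trace_conjTranspose_opTransfer_mul]
  simp only [Matrix.conjTranspose_mul, Matrix.conjTranspose_conjTranspose, mul_assoc]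
  rw [Matrix.trace_mul_comm]
  simp only [mul_assoc]

theorem dualOp_gaugeTransform (c : ℂ) (V : GL (Fin χ) ℂ) (A : Tensor d χ)
    (Y : Matrix (Fin χ) (Fin χ) ℂ) :
    dualOp (gaugeTransform c V A) Y = dualOp A (star c • ((V⁻¹.val)ᴴ * Y * (V.val)ᴴ)) := by
  ext j i
  simp only [dualOp_apply, gaugeTransform, Matrix.conjTranspose_smul, Matrix.conjTranspose_mul,
    smul_mul_assoc, mul_smul_comm, Matrix.trace_smul]
  rw [mul_assoc, Matrix.trace_mul_comm]
  simp only [mul_assoc]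

theorem StrongInjective.dualOp_injective (hA : StrongInjective A) :
    Function.Injective (dualOp A) := by
  refine (injective_iff_map_eq_zero _).2 fun Y hY => ?_
  have hzero : Y.map star = 0 := @hA.injective (Y.map star) 0 <| funext₂ fun i j => by
    have htrace := congrArg star ((dualOp_apply A Y i j).symm.trans (congrFun₂ hY j i))
    refine Finset.sum_comm.trans ?_
    simpa [Matrix.trace, Matrix.mul_apply] using htrace
  ext a b
  simpa using congrFun₂ hzero a b

theorem opTransfer_comp_dualOp_injective (hA : Function.Injective (dualOp A)) :
    Function.Injective (opTransfer A ∘ₗ dualOp A) := by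
  refine (injective_iff_map_eq_zero _).2 fun Y hY => (injective_iff_map_eq_zero _).1 hA Y ?_
  rw [← Matrix.trace_conjTranspose_mul_self_eq_zero_iff, ← trace_conjTranspose_opTransfer_mul]
  rw [LinearMap.comp_apply] at hY
  rw [hY, Matrix.conjTranspose_zero, zero_mul, Matrix.trace_zero]

/-- The Gram automorphism `opTransfer A ∘ dualOp A` of the virtual matrices. -/
noncomputable def gramEquiv (hA : Function.Injective (dualOp A)) :
    Matrix (Fin χ) (Fin χ) ℂ ≃ₗ[ℂ] Matrix (Fin χ) (Fin χ) ℂ :=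
  LinearEquiv.ofInjectiveEndo _ (opTransfer_comp_dualOp_injective hA)

/-- The right inverse of `opTransfer A` with values in the range of `dualOp A`, so that
`liftOp hA X` is the operator of minimal norm with transfer matrix `X`. -/
noncomputable def liftOp (hA : Function.Injective (dualOp A)) :
    Matrix (Fin χ) (Fin χ) ℂ →ₗ[ℂ] Matrix (Fin d) (Fin d) ℂ :=
  dualOp A ∘ₗ (gramEquiv hA).symm.toLinearMap

theorem opTransfer_liftOp (hA : Function.Injective (dualOp A)) (X : Matrix (Fin χ) (Fin χ) ℂ) :
    opTransfer A (liftOp hA X) = X :=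
  (gramEquiv hA).apply_symm_apply X

theorem liftOp_opTransfer_dualOp (hA : Function.Injective (dualOp A))
    (Y : Matrix (Fin χ) (Fin χ) ℂ) : liftOp hA (opTransfer A (dualOp A Y)) = dualOp A Y :=
  congrArg (dualOp A) ((gramEquiv hA).symm_apply_apply Y)

-- Both symmetries preserve the range of `dualOp A`, on which `opTransfer A` is injective.
theorem mul_liftOp_mul_conjTranspose (hA : Function.Injective (dualOp A))
    {u v : Matrix (Fin d) (Fin d) ℂ} (hu : uᴴ * u = 1) (hv : vᴴ * v = 1) {c : ℂ} (hc : c ≠ 0)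
    {V : GL (Fin χ) ℂ} (hV : leftRight u v A = gaugeTransform c V A)
    (X : Matrix (Fin χ) (Fin χ) ℂ) :
    v * liftOp hA X * uᴴ = liftOp hA (c⁻¹ • (V.val * X * V⁻¹.val)) := by
  obtain ⟨Z, hZ⟩ : ∃ Z, v * liftOp hA X * uᴴ = dualOp A Z :=
    ⟨_, by rw [liftOp, LinearMap.comp_apply, ← dualOp_leftRight, hV, dualOp_gaugeTransform]⟩
  have htransfer : X = c • (V⁻¹.val * opTransfer A (v * liftOp hA X * uᴴ) * V.val) := by
    rw [← opTransfer_gaugeTransform, ← hV, opTransfer_leftRight,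
      show vᴴ * (v * liftOp hA X * uᴴ) * u = (vᴴ * v) * liftOp hA X * (uᴴ * u) by
        simp only [mul_assoc], hu, hv, one_mul, mul_one, opTransfer_liftOp]
  rw [hZ, ← liftOp_opTransfer_dualOp hA, ← hZ]
  congr 1
  nth_rw 2 [htransfer]
  simp only [mul_smul_comm, smul_mul_assoc, inv_smul_smul₀ hc, mul_assoc, Units.mul_inv,
    Units.mul_inv_cancel_left, mul_one]

end OperatorLift

section FundamentalTheorem

variable {ι K M : Type*} [Fintype ι] [Field K] [AddCommGroup M] [Module K M]

theorem exists_linearEquiv_of_trace_mul_eq {a b : M →ₗ[K] Matrix ι ι K}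
    (ha : Function.Surjective a) {c : K} (hc : c ≠ 0)
    (htrace : ∀ x y, (b x * b y).trace = c * (a x * a y).trace) :
    ∃ Φ : Matrix ι ι K ≃ₗ[K] Matrix ι ι K, ∀ x, b x = Φ (a x) := by
  obtain ⟨s, hs⟩ := a.exists_rightInverse_of_surjective (LinearMap.range_eq_top.2 ha)
  have has : ∀ X, a (s X) = X := LinearMap.congr_fun hs
  have hinj : Function.Injective (b ∘ₗ s) := by
    refine (injective_iff_map_eq_zero _).2 fun X hX => Matrix.ext_iff_trace_mul_right.2 fun Z => ?_
    have h := htrace (s X) (s Z)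
    rw [LinearMap.comp_apply] at hX
    rw [hX, zero_mul, Matrix.trace_zero, has, has, eq_comm, mul_eq_zero] at h
    rw [h.resolve_left hc, zero_mul, Matrix.trace_zero]
  refine ⟨LinearEquiv.ofInjectiveEndo _ hinj, fun x => Matrix.ext_iff_trace_mul_right.2 fun Z => ?_⟩
  obtain ⟨Y, rfl⟩ := (LinearEquiv.ofInjectiveEndo _ hinj).surjective Z
  change (b x * b (s Y)).trace = (b (s (a x)) * b (s Y)).trace
  rw [htrace, htrace, has, has]

variable [DecidableEq ι]

theorem exists_conj_of_map_mul (Φ : Matrix ι ι K ≃ₗ[K] Matrix ι ι K)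
    (hΦ : ∀ X Y, Φ (X * Y) = Φ X * Φ Y) :
    ∃ V : GL ι K, ∀ X, Φ X = V⁻¹.val * X * V.val := by
  have hone : Φ 1 = 1 := by
    obtain ⟨E, hE⟩ := Φ.surjective 1
    simpa only [one_mul, hE, mul_one] using (hΦ 1 E).symm
  obtain ⟨f, hf⟩ := AlgEquiv.eq_linearEquivConjAlgEquiv
    (Matrix.toLinAlgEquiv'.symm.trans ((AlgEquiv.ofLinearEquiv Φ hone hΦ).trans
      Matrix.toLinAlgEquiv'))
  let V : GL ι K :=
    { val := LinearMap.toMatrix' f.symm.toLinearMap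
      inv := LinearMap.toMatrix' f.toLinearMap
      val_inv := by rw [← LinearMap.toMatrix'_comp]; simp
      inv_val := by rw [← LinearMap.toMatrix'_comp]; simp }
  refine ⟨V, fun X => Matrix.toLin'.injective ?_⟩
  have hX : Matrix.toLin' (Φ X) = f.toLinearMap ∘ₗ Matrix.toLin' X ∘ₗ f.symm.toLinearMap := by
    simpa [LinearEquiv.conjAlgEquiv_apply] using! DFunLike.congr_fun hf (Matrix.toLinAlgEquiv' X)
  rw [hX, mul_assoc, Matrix.toLin'_mul, Matrix.toLin'_mul]
  simp only [V, Units.inv_mk, Matrix.toLin'_toMatrix']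

theorem exists_conj_of_trace_mul_eq {a b : M →ₗ[K] Matrix ι ι K} (ha : Function.Surjective a)
    {c₂ c₃ : K} (hc₂ : c₂ ≠ 0) (hc₃ : c₃ ≠ 0)
    (h₂ : ∀ x y, (b x * b y).trace = c₂ * (a x * a y).trace)
    (h₃ : ∀ x y z, (b x * b y * b z).trace = c₃ * (a x * a y * a z).trace) :
    ∃ V : GL ι K, ∀ x, b x = (c₃ / c₂) • (V⁻¹.val * a x * V.val) := by
  obtain ⟨Φ, hΦ⟩ := exists_linearEquiv_of_trace_mul_eq ha hc₂ h₂
  have hmul : ∀ X Y, Φ X * Φ Y = (c₃ / c₂) • Φ (X * Y) := by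
    intro X Y
    refine Matrix.ext_iff_trace_mul_right.2 fun Z => ?_
    obtain ⟨x, rfl⟩ := ha X
    obtain ⟨y, rfl⟩ := ha Y
    obtain ⟨z, rfl⟩ := (Φ.surjective.comp ha) Z
    obtain ⟨w, hw⟩ := ha (a x * a y)
    rw [Function.comp_apply, ← hw, ← hΦ, ← hΦ, ← hΦ, ← hΦ, h₃, smul_mul_assoc, Matrix.trace_smul,
      h₂, hw, smul_eq_mul, ← mul_assoc, div_mul_cancel₀ _ hc₂]
  have hκ : c₃ / c₂ ≠ 0 := div_ne_zero hc₃ hc₂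
  obtain ⟨V, hV⟩ := exists_conj_of_map_mul
    (Φ.trans (LinearEquiv.smulOfNeZero K _ (c₃ / c₂)⁻¹ (inv_ne_zero hκ))) fun X Y => by
      simp only [LinearEquiv.trans_apply, LinearEquiv.smulOfNeZero_apply, smul_mul_smul_comm, hmul,
        mul_smul, inv_smul_smul₀ hκ]
  refine ⟨V, fun x => ?_⟩
  rw [← hV, hΦ, LinearEquiv.trans_apply, LinearEquiv.smulOfNeZero_apply, smul_inv_smul₀ hκ]

variable {d χ L : ℕ} {A B : Tensor d χ}

theorem trace_prod_opTransfer_of_mpdo_eq_smul {c : ℂ} (h : mpdo B L = c • mpdo A L)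
    (O : Fin L → Matrix (Fin d) (Fin d) ℂ) :
    ((List.ofFn fun x => opTransfer B (O x)).prod).trace =
      c * ((List.ofFn fun x => opTransfer A (O x)).prod).trace := by
  rw [← trace_mpdo_mul_siteProd, h, smul_mul_assoc, Matrix.trace_smul, trace_mpdo_mul_siteProd,
    smul_eq_mul]

theorem exists_eq_gaugeTransform (hA : Function.Injective (dualOp A)) {c₂ c₃ : Circle}
    (h₂ : mpdo B 2 = (c₂ : ℂ) • mpdo A 2) (h₃ : mpdo B 3 = (c₃ : ℂ) • mpdo A 3) :
    ∃ (κ : Circle) (V : GL (Fin χ) ℂ), B = gaugeTransform κ V A := by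
  obtain ⟨V, hV⟩ := exists_conj_of_trace_mul_eq (a := opTransfer A) (b := opTransfer B)
    (fun X => ⟨_, opTransfer_liftOp hA X⟩) (Circle.coe_ne_zero c₂) (Circle.coe_ne_zero c₃)
    (fun O₁ O₂ => by simpa [List.ofFn_succ] using
      trace_prod_opTransfer_of_mpdo_eq_smul h₂ ![O₁, O₂])
    (fun O₁ O₂ O₃ => by simpa [List.ofFn_succ, mul_assoc] using
      trace_prod_opTransfer_of_mpdo_eq_smul h₃ ![O₁, O₂, O₃])
  refine ⟨c₃ / c₂, V, opTransfer_injective <| LinearMap.ext fun O => ?_⟩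
  rw [hV, opTransfer_gaugeTransform, Circle.coe_div]

end FundamentalTheorem

section GaugeUniqueness

variable {χ d : ℕ} {A : Tensor d χ}

theorem StrongInjective.virtualDim_pos (hA : StrongInjective A) : 0 < χ := by
  obtain ⟨l, hl, -⟩ := hA.gap
  rcases Nat.eq_zero_or_pos χ with rfl | hχ
  · rw [Matrix.charpoly, Matrix.det_isEmpty, ← Polynomial.C_1, Polynomial.rootMultiplicity_C] at hl
    exact absurd hl zero_ne_one
  · exact hχ

theorem gaugeTransform_smul (c : ℂ) (z : ℂˣ) (V : GL (Fin χ) ℂ) (A : Tensor d χ) :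
    gaugeTransform c (z • V) A = gaugeTransform c V A := by
  funext i j
  simp only [gaugeTransform, Units.smul_inv, Units.val_smul, smul_mul_assoc, mul_smul_comm,
    smul_smul, one_smul, Units.smul_def, Units.mul_inv]

theorem exists_units_smul_det_eq_one (hχ : 0 < χ) (V : GL (Fin χ) ℂ) :
    ∃ z : ℂˣ, (z • V).val.det = 1 := by
  have hdet : V.val.det ≠ 0 := ((Matrix.isUnit_iff_isUnit_det _).1 V.isUnit).ne_zero
  obtain ⟨z, hz⟩ := IsAlgClosed.exists_pow_nat_eq (V.val.det)⁻¹ hχ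
  have hz₀ : z ≠ 0 := by
    rintro rfl
    exact inv_ne_zero hdet (by rw [← hz, zero_pow hχ.ne'])
  refine ⟨Units.mk0 z hz₀, ?_⟩
  rw [Units.val_smul, Units.smul_mk0, Matrix.det_smul, Fintype.card_fin, hz,
    inv_mul_cancel₀ hdet]

theorem exists_eq_smul_of_gaugeTransform_eq (hA : Function.Injective (dualOp A)) {c c' : ℂ}
    (hc : c ≠ 0) {V W : GL (Fin χ) ℂ} (h : gaugeTransform c W A = gaugeTransform c' V A) :
    ∃ a : ℂ, W.val = a • V.val := by
  have hconj : ∀ X, c • (W⁻¹.val * X * W.val) = c' • (V⁻¹.val * X * V.val) := fun X => by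
    have := congrArg (fun B => opTransfer B (liftOp hA X)) h
    simpa only [opTransfer_gaugeTransform, opTransfer_liftOp] using this
  rcases isEmpty_or_nonempty (Fin χ) with hχ | ⟨⟨a⟩⟩
  · exact ⟨0, Subsingleton.elim _ _⟩
  obtain rfl : c = c' := by
    simpa using congrFun (congrFun (hconj 1) a) a
  have hcomm : ∀ X, Commute X (W * V⁻¹).val := fun X => by
    have hX := smul_right_injective _ hc (hconj X)
    calc X * (W * V⁻¹).val = W.val * (W⁻¹.val * X * W.val) * V⁻¹.val := by simp [mul_assoc]
      _ = (W * V⁻¹).val * X := by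
        rw [hX]
        simp [mul_assoc]
  obtain ⟨z, hz⟩ := Matrix.mem_range_scalar_iff_commute_single'.2 fun i j => hcomm (.single i j 1)
  refine ⟨z, ?_⟩
  calc W.val = (W * V⁻¹).val * V.val := by simp [mul_assoc]
    _ = z • V.val := by
      rw [← hz, Matrix.scalar_apply, ← Matrix.smul_one_eq_diagonal, smul_mul_assoc, one_mul]

end GaugeUniqueness

section DoubledAction

variable {G K : Type*} [Group G] [Group K] (ρ : SymmetricMPDO G K)

/-- The action of the doubled group on all tensors with the physical dimension of `ρ`, of which
`SymmetricMPDO.act` is the value at `ρ.A`. -/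
noncomputable def SymmetricMPDO.actOn {χ : ℕ} (x : DoubledGroup G K) (B : Tensor ρ.d χ) :
    Tensor ρ.d χ :=
  leftRight (ρ.onSite (x.left.1, x.left.2.2)).val (ρ.onSite (x.left.2.1, x.left.2.2)).val
    (if antiSign G K x = 1 then B else hermTensor B)

theorem SymmetricMPDO.act_eq_actOn (x : DoubledGroup G K) : ρ.act x = ρ.actOn x ρ.A := by
  funext i j
  simp only [SymmetricMPDO.act, SymmetricMPDO.actOn, leftRight]
  split_ifs <;> rfl

theorem SymmetricMPDO.actOn_mul {χ : ℕ} (x y : DoubledGroup G K) (B : Tensor ρ.d χ) :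
    ρ.actOn (x * y) B = ρ.actOn x (ρ.actOn y B) := by
  have hval : ∀ p q : G × K, (ρ.onSite p).val * (ρ.onSite q).val = (ρ.onSite (p * q)).val :=
    fun p q => by rw [map_mul]; rfl
  simp only [SymmetricMPDO.actOn, SemidirectProduct.mul_left, SemidirectProduct.mul_right,
    SemidirectProduct.rightHom_eq_right]
  obtain ⟨⟨g, h, k⟩, s⟩ := x
  obtain ⟨⟨g', h', k'⟩, t⟩ := y
  rcases Int.units_eq_one_or s with rfl | rfl <;> rcases Int.units_eq_one_or t with rfl | rfl <;>
    simp [-SemidirectProduct.mk_eq_inl_mul_inr, hermAction, swapAut, hermTensor_leftRight,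
      leftRight_leftRight, hval, hermTensor_hermTensor]

theorem SymmetricMPDO.actOn_gaugeTransform {χ : ℕ} (x : DoubledGroup G K) (κ : Circle)
    (V : GL (Fin χ) ℂ) (B : Tensor ρ.d χ) :
    ∃ κ' : Circle, ρ.actOn x (gaugeTransform κ V B) =
      gaugeTransform κ' (twist x V) (ρ.actOn x B) := by
  unfold SymmetricMPDO.actOn twist
  split_ifs
  · exact ⟨κ, leftRight_gaugeTransform ..⟩
  · refine ⟨κ⁻¹, ?_⟩
    rw [hermTensor_gaugeTransform, leftRight_gaugeTransform, Circle.coe_inv_eq_conj]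
    rfl

theorem globalOp_mul {d : ℕ} (u v : Matrix.unitaryGroup (Fin d) ℂ) (L : ℕ) :
    globalOp (u * v) L = globalOp u L * globalOp v L := by
  rw [globalOp, globalOp, globalOp, siteProd_mul]
  rfl

theorem SymmetricMPDO.mpdo_act (x : DoubledGroup G K) (L : ℕ) :
    ∃ c : Circle, mpdo (ρ.act x) L = (c : ℂ) • mpdo ρ.A L := by
  have hherm : mpdo (if antiSign G K x = 1 then ρ.A else hermTensor ρ.A) L = mpdo ρ.A L := by
    split_ifs
    · rfl
    · rw [mpdo_hermTensor, (ρ.posSemidef L).isHermitian.eq]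
  have honSite : ∀ p, globalOp (ρ.onSite p) L = globalOp (ρ.U p.1) L * globalOp (ρ.W p.2) L :=
    fun _ => globalOp_mul ..
  obtain ⟨a, ha, -⟩ := ρ.strong L x.left.1
  obtain ⟨b, -, hb⟩ := ρ.strong L x.left.2.1
  refine ⟨a * b⁻¹, ?_⟩
  rw [ρ.act_eq_actOn, SymmetricMPDO.actOn, mpdo_leftRight, hherm]
  change globalOp (ρ.onSite _) L * mpdo ρ.A L * (globalOp (ρ.onSite _) L)ᴴ = _
  calc
    _ = globalOp (ρ.U x.left.1) L * (globalOp (ρ.W x.left.2.2) L * mpdo ρ.A L *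
        (globalOp (ρ.W x.left.2.2) L)ᴴ) * (globalOp (ρ.U x.left.2.1) L)ᴴ := by
      rw [honSite, honSite, Matrix.conjTranspose_mul]
      simp only [mul_assoc]
    _ = ((a * b⁻¹ : Circle) : ℂ) • mpdo ρ.A L := by
      rw [ρ.weak, ha, smul_mul_assoc, hb, smul_smul, Circle.coe_mul]

theorem SymmetricMPDO.exists_act_eq_gaugeTransform (x : DoubledGroup G K) :
    ∃ (κ : Circle) (V : GL (Fin ρ.χ) ℂ), V.val.det = 1 ∧ ρ.act x = gaugeTransform κ V ρ.A := by
  obtain ⟨_, h₂⟩ := ρ.mpdo_act x 2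
  obtain ⟨_, h₃⟩ := ρ.mpdo_act x 3
  obtain ⟨κ, V, hV⟩ := exists_eq_gaugeTransform ρ.strongInjective.dualOp_injective h₂ h₃
  obtain ⟨z, hz⟩ := exists_units_smul_det_eq_one ρ.strongInjective.virtualDim_pos V
  exact ⟨κ, z • V, hz, hV.trans (gaugeTransform_smul ..).symm⟩

variable {ρ}

theorem SymmetricMPDO.exists_mul_twist_eq_smul {V : DoubledGroup G K → GL (Fin ρ.χ) ℂ}
    {κ : DoubledGroup G K → Circle} (hV : ∀ x, ρ.act x = gaugeTransform (κ x) (V x) ρ.A)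
    (x y : DoubledGroup G K) : ∃ c : ℂ, (V x * twist x (V y)).val = c • (V (x * y)).val := by
  obtain ⟨κ', hκ'⟩ := ρ.actOn_gaugeTransform x (κ y) (V y) ρ.A
  refine exists_eq_smul_of_gaugeTransform_eq ρ.strongInjective.dualOp_injective
    (mul_ne_zero (Circle.coe_ne_zero κ') (Circle.coe_ne_zero (κ x))) (c' := κ (x * y)) ?_
  rw [← gaugeTransform_gaugeTransform, ← hV, ← hV, ρ.act_eq_actOn, ← hκ', ← hV,
    ρ.act_eq_actOn y, ← ρ.actOn_mul, ← ρ.act_eq_actOn]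

theorem det_twist_eq_one {χ : ℕ} (x : DoubledGroup G K) {V : GL (Fin χ) ℂ}
    (hV : V.val.det = 1) : (twist x V).val.det = 1 := by
  rw [twist]
  split_ifs
  · exact hV
  · exact (RingHom.map_det (starRingEnd ℂ) V.val).symm.trans (by rw [hV, map_one])

theorem SymmetricMPDO.exists_isProjectiveAction (ρ : SymmetricMPDO G K) :
    ∃ V ω, ρ.IsProjectiveAction V ω := by
  choose κ V hdet hV using ρ.exists_act_eq_gaugeTransform
  choose c hc using SymmetricMPDO.exists_mul_twist_eq_smul hV
  have hnorm : ∀ x y, ‖c x y‖ = 1 := fun x y => by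
    have h := congrArg Matrix.det (hc x y)
    rw [Units.val_mul, Matrix.det_mul, hdet, det_twist_eq_one x (hdet y), Matrix.det_smul, hdet,
      mul_one, mul_one, Fintype.card_fin] at h
    exact Complex.norm_eq_one_of_pow_eq_one h.symm ρ.strongInjective.virtualDim_pos.ne'
  exact ⟨V, fun x y => ⟨c x y, mem_sphere_zero_iff_norm.2 (hnorm x y)⟩,
    ⟨κ, fun x i j => congrFun (congrFun (hV x) i) j⟩, hc⟩

end DoubledAction

section RankOne

variable {ι : Type*} [Fintype ι]

theorem trace_vecMulVec_mul (r s : ι → ℂ) (X : Matrix ι ι ℂ) :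
    (Matrix.vecMulVec r s * X).trace = s ⬝ᵥ (X *ᵥ r) := by
  rw [Matrix.vecMulVec_mul, Matrix.trace_vecMulVec, dotProduct_comm r, ← Matrix.dotProduct_mulVec]

theorem trace_vecMulVec_mul_vecMulVec_mul (r s : ι → ℂ) (X Y : Matrix ι ι ℂ) :
    (Matrix.vecMulVec r s * X * Matrix.vecMulVec r s * Y).trace =
      (s ⬝ᵥ (X *ᵥ r)) * (s ⬝ᵥ (Y *ᵥ r)) := by
  rw [Matrix.vecMulVec_mul, Matrix.vecMulVec_mul_vecMulVec, trace_vecMulVec_mul,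
    Matrix.dotProduct_mulVec s, smul_dotProduct, Matrix.dotProduct_mulVec, smul_eq_mul]

theorem map_star_mulVec (M : Matrix ι ι ℂ) (v : ι → ℂ) :
    M.map (starRingEnd ℂ) *ᵥ star v = star (M *ᵥ v) := by
  ext i
  simp [Matrix.mulVec, dotProduct]

end RankOne

section DominantTransfer

variable {ι : Type*} [Fintype ι] [DecidableEq ι] {T T' : Matrix ι ι ℂ} {l : ℝ} {r s r' s' : ι → ℂ}

theorem trace_eq_of_gap_of_nonpos (hl : l ≤ 0) (hmult : T.charpoly.rootMultiplicity (l : ℂ) = 1)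
    (hgap : ∀ m : ℂ, T.charpoly.IsRoot m → m ≠ (l : ℂ) → ‖m‖ < l) : T.trace = l := by
  have hroots : T.charpoly.roots = Multiset.replicate T.charpoly.roots.card (l : ℂ) :=
    Multiset.eq_replicate_card.2 fun m hm => by
      by_contra hne
      exact ((norm_nonneg m).trans_lt (hgap m (Polynomial.isRoot_of_mem_roots hm) hne)).not_ge hl
  have hcard : T.charpoly.roots.card = 1 := by
    rw [← hmult, ← Polynomial.count_roots]
    conv_rhs => rw [hroots]
    rw [Multiset.count_replicate_self]
  rw [Matrix.trace_eq_sum_roots_charpoly, hroots, hcard, Multiset.replicate_one,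
    Multiset.sum_singleton]

theorem StrongInjective.gap_pos {d χ : ℕ} {A : Tensor d χ} (hA : StrongInjective A)
    (hpos : (mpdo A 1).PosSemidef)
    (hmult : (transfer A).charpoly.rootMultiplicity (l : ℂ) = 1)
    (hgap : ∀ m : ℂ, (transfer A).charpoly.IsRoot m → m ≠ (l : ℂ) → ‖m‖ < l) : 0 < l := by
  by_contra! hl
  have htrace : (mpdo A 1).trace = l := by
    rw [trace_mpdo, pow_one, trace_eq_of_gap_of_nonpos hl hmult hgap]
  have hl₀ : l = 0 := le_antisymm hl (by exact_mod_cast htrace ▸ hpos.trace_nonneg)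
  have hzero : mpdo A 1 = 0 := hpos.trace_eq_zero_iff.1 (by rw [htrace, hl₀, Complex.ofReal_zero])
  have hone := trace_mpdo_mul_siteProd A fun _ : Fin 1 => liftOp hA.dualOp_injective 1
  rw [hzero, zero_mul, Matrix.trace_zero, opTransfer_liftOp, List.ofFn_const, List.replicate_one,
    List.prod_singleton, Matrix.trace_one, Fintype.card_fin, eq_comm, Nat.cast_eq_zero] at hone
  exact hA.virtualDim_pos.ne' hone

theorem SymmetricMPDO.exists_dominant {G K : Type*} [Group G] [Group K] (ρ : SymmetricMPDO G K) :
    ∃ l r s, Dominant (transfer ρ.A) l r s := by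
  obtain ⟨l, hmult, hgap⟩ := ρ.strongInjective.gap
  exact ⟨l, MixedSPT.exists_dominant
    (ρ.strongInjective.gap_pos (ρ.posSemidef 1) hmult hgap) hmult hgap⟩

namespace Dominant

theorem right_ne_zero (h : Dominant T l r s) : r ≠ 0 := by
  rintro rfl
  simpa using h.dot

theorem map_star (h : Dominant T l r s) :
    Dominant (T.map (starRingEnd ℂ)) l (star r) (star s) where
  pos := h.pos
  dot := by rw [Matrix.star_dotProduct_star, dotProduct_comm, h.dot, star_one]
  tendsto := by
    have hpow : ∀ k : ℕ, ((l : ℂ)⁻¹ • T.map (starRingEnd ℂ)) ^ k =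
        (((l : ℂ)⁻¹ • T) ^ k).map (starRingEnd ℂ) := fun k => by
      have hsmul : (l : ℂ)⁻¹ • T.map (starRingEnd ℂ) =
          (starRingEnd ℂ).mapMatrix ((l : ℂ)⁻¹ • T) := by
        ext i j
        simp
      rw [hsmul, ← map_pow, RingHom.mapMatrix_apply]
    have hlim : (Matrix.vecMulVec r s).map (starRingEnd ℂ) =
        Matrix.vecMulVec (star r) (star s) := by
      ext i j
      simp [Matrix.vecMulVec_apply]
    simp_rw [hpow, ← hlim]
    exact ((continuous_id.matrix_map Complex.continuous_conj).tendsto _).comp h.tendsto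

theorem tendsto_trace (h : Dominant T l r s) :
    Tendsto (fun k : ℕ => (((l : ℂ)⁻¹ • T) ^ k).trace) atTop (𝓝 1) := by
  have hone : (Matrix.vecMulVec r s).trace = 1 := by
    rw [Matrix.trace_vecMulVec, dotProduct_comm, h.dot]
  exact hone ▸ ((continuous_id.matrix_trace).tendsto _).comp h.tendsto

section Gauge

variable {V : GL ι ℂ}

-- Both `tr (T / l) ^ k` and `tr (T' / l) ^ k = κ ^ k tr (T / l) ^ k` converge to `1`.
theorem gauge_phase_eq_one (h : Dominant T l r s) (h' : Dominant T' l r' s') {κ : ℂ}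
    (hT : T' = κ • (V⁻¹.val * T * V.val)) : κ = 1 := by
  have hpow : ∀ k : ℕ, (((l : ℂ)⁻¹ • T') ^ k).trace = κ ^ k * (((l : ℂ)⁻¹ • T) ^ k).trace :=
    fun k => by
    rw [hT, smul_comm, smul_pow, ← smul_mul_assoc, ← mul_smul_comm, Units.conj_pow',
      Matrix.trace_smul, Matrix.trace_units_conj', smul_eq_mul]
  have hlim : Tendsto (fun k : ℕ => κ ^ k) atTop (𝓝 1) := by
    have hquot := h'.tendsto_trace.div h.tendsto_trace one_ne_zero
    rw [div_one] at hquot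
    refine hquot.congr' ?_
    filter_upwards [h.tendsto_trace.eventually_ne one_ne_zero] with k hk
    rw [Pi.div_apply, hpow, mul_div_cancel_right₀ _ hk]
  have hsucc := hlim.const_mul κ
  simp_rw [← pow_succ', mul_one] at hsucc
  exact tendsto_nhds_unique hsucc (hlim.comp (tendsto_add_atTop_nat 1))

theorem gauge_mul_vecMulVec (h : Dominant T l r s) (h' : Dominant T' l r' s')
    (hT : T' = V⁻¹.val * T * V.val) :
    V.val * Matrix.vecMulVec r' s' = Matrix.vecMulVec r s * V.val := by
  have hpow : ∀ k : ℕ, V.val * ((l : ℂ)⁻¹ • T') ^ k = ((l : ℂ)⁻¹ • T) ^ k * V.val := fun k => by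
    have hsemi : SemiconjBy V.val ((l : ℂ)⁻¹ • T') ((l : ℂ)⁻¹ • T) := by
      rw [SemiconjBy, hT, mul_smul_comm, smul_mul_assoc, ← mul_assoc, ← mul_assoc, Units.mul_inv,
        one_mul]
    exact hsemi.pow_right k
  refine tendsto_nhds_unique (h'.tendsto.const_mul V.val) ?_
  simp_rw [hpow]
  exact h.tendsto.mul_const V.val

theorem exists_gauge_mulVec_eq_smul (h : Dominant T l r s) (h' : Dominant T' l r' s')
    (hT : T' = V⁻¹.val * T * V.val) : ∃ c : ℂ, c ≠ 0 ∧ V.val *ᵥ r' = c • r := by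
  have hVr : V.val *ᵥ r' = (s ⬝ᵥ V.val *ᵥ r') • r := by
    have := congrArg (· *ᵥ r') (h.gauge_mul_vecMulVec h' hT)
    simpa only [← Matrix.mulVec_mulVec, Matrix.vecMulVec_mulVec, h'.dot, MulOpposite.op_one,
      one_smul, op_smul_eq_smul] using this
  refine ⟨_, fun h₀ => h'.right_ne_zero ?_, hVr⟩
  rw [h₀, zero_smul] at hVr
  rw [← Matrix.one_mulVec r', ← Units.inv_mul V, ← Matrix.mulVec_mulVec, hVr, Matrix.mulVec_zero]

end Gauge

end Dominant

end DominantTransfer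

theorem prod_map_range_string {M : Type*} [Monoid M] (F : ℕ → M) (a n b : ℕ) {t x u y : M}
    (hleft : ∀ i < a, F i = t) (hx : F a = x) (hstring : ∀ i < n, F (a + 1 + i) = u)
    (hy : F (a + 1 + n) = y) (hright : ∀ i < b, F (a + 1 + n + 1 + i) = t) :
    ((List.range (a + 1 + n + 1 + b)).map F).prod = t ^ a * x * u ^ n * y * t ^ b := by
  have hconst : ∀ {f : ℕ → M} {c : M} {m : ℕ}, (∀ i < m, f i = c) →
      ((List.range m).map f).prod = c ^ m := fun h => by
    rw [List.map_congr_left fun i hi => h i (List.mem_range.1 hi), List.map_const',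
      List.prod_replicate, List.length_range]
  rw [List.range_add, List.range_succ, List.range_add, List.range_succ]
  simp only [List.map_append, List.prod_append, List.map_map, List.map_singleton,
    List.prod_singleton, hx, hy]
  rw [hconst hleft, hconst (f := F ∘ (a + 1 + ·)) hstring,
    hconst (f := F ∘ (a + 1 + n + 1 + ·)) hright]

section StringExpectation

variable {d χ : ℕ} {A : Tensor d χ} {u : Matrix (Fin d) (Fin d) ℂ}

theorem trace_mpdo_mul_stringOp (A : Tensor d χ) (u R' R : Matrix (Fin d) (Fin d) ℂ) {L : ℕ}
    {x₁ x₂ : Fin L} (h : x₁ < x₂) :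
    (mpdo A L * stringOp u R' R x₁ x₂).trace =
      (transfer A ^ (x₁ + (L - 1 - x₂) : ℕ) * opTransfer A R' *
        opTransfer A u ^ (x₂ - x₁ - 1 : ℕ) * opTransfer A R).trace := by
  obtain ⟨a, ha⟩ := x₁
  obtain ⟨c, hc⟩ := x₂
  replace h : a < c := h
  obtain ⟨n, rfl⟩ : ∃ n, c = a + 1 + n := ⟨c - a - 1, by omega⟩
  obtain ⟨b, rfl⟩ : ∃ b, L = a + 1 + n + 1 + b := ⟨L - (a + 1 + n + 1), by omega⟩
  let F : ℕ → Matrix (Fin χ) (Fin χ) ℂ := fun x => opTransfer A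
    (if x = a then R' else if x = a + 1 + n then R else if a < x ∧ x < a + 1 + n then u else 1)
  have hF : (List.ofFn fun x : Fin (a + 1 + n + 1 + b) => opTransfer A
      (if x = ⟨a, ha⟩ then R' else if x = ⟨a + 1 + n, hc⟩ then R
        else if ⟨a, ha⟩ < x ∧ x < ⟨a + 1 + n, hc⟩ then u else 1)) =
      (List.range (a + 1 + n + 1 + b)).map F := by
    rw [List.ofFn_eq_map, ← List.map_coe_finRange_eq_range, List.map_map]
    simp only [Fin.ext_iff, Fin.lt_def, F]
    rfl
  have hprod : ((List.range (a + 1 + n + 1 + b)).map F).prod = transfer A ^ a * opTransfer A R' *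
      opTransfer A u ^ n * opTransfer A R * transfer A ^ b := by
    apply prod_map_range_string <;> intros <;> simp only [F] <;> grind [opTransfer_one]
  rw [stringOp, trace_mpdo_mul_siteProd, hF, hprod, Matrix.trace_mul_comm,
    show a + 1 + n - a - 1 = n by omega,
    show a + (a + 1 + n + 1 + b - 1 - (a + 1 + n)) = b + a by omega, pow_add]
  simp only [mul_assoc]

/-- The limit of a string expectation value, up to the phases accumulated along the string, for a
transfer matrix with dominant eigenvalue `l` and right and left eigenvectors `r` and `s`. The string
acts on the virtual space through conjugation by `V`. -/
noncomputable def stringValue (A : Tensor d χ) (l : ℝ) (r s : Fin χ → ℂ) (V : GL (Fin χ) ℂ)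
    (R' R : Matrix (Fin d) (Fin d) ℂ) : ℂ :=
  (s ⬝ᵥ ((opTransfer A R' * V⁻¹.val) *ᵥ r)) * (s ⬝ᵥ ((V.val * opTransfer A R) *ᵥ r)) / l ^ 2

theorem Dominant.tendsto_trace_pow_mul_pow_mul {ι : Type*} [Fintype ι] [DecidableEq ι]
    {T : Matrix ι ι ℂ} {l : ℝ} {r s : ι → ℂ} (h : Dominant T l r s) (X Y : Matrix ι ι ℂ) :
    Tendsto (fun p : ℕ × ℕ =>
        (((l : ℂ)⁻¹ • T) ^ p.1 * X * ((l : ℂ)⁻¹ • T) ^ p.2 * Y).trace /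
          (((l : ℂ)⁻¹ • T) ^ (p.1 + p.2 + 2)).trace)
      (atTop ×ˢ atTop) (𝓝 ((s ⬝ᵥ (X *ᵥ r)) * (s ⬝ᵥ (Y *ᵥ r)))) := by
  have hnum := (continuous_id.matrix_trace.tendsto _).comp
    ((((h.tendsto.comp tendsto_fst).mul_const X).mul
      (h.tendsto.comp (tendsto_snd (f := atTop (α := ℕ))))).mul_const Y)
  have hden := h.tendsto_trace.comp (tendsto_atTop_mono
    (f := fun p : ℕ × ℕ => p.1) (g := fun p => p.1 + p.2 + 2) (by omega)
    (tendsto_fst (g := atTop (α := ℕ))))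
  have hquot := hnum.div hden one_ne_zero
  rw [div_one] at hquot
  exact trace_vecMulVec_mul_vecMulVec_mul r s X Y ▸ hquot

theorem expect_stringOp {l : ℝ} (hl : l ≠ 0) {κ : ℂ} {V : GL (Fin χ) ℂ}
    (hu : opTransfer A u = κ • (V⁻¹.val * transfer A * V.val)) (R' R : Matrix (Fin d) (Fin d) ℂ)
    {L : ℕ} {x₁ x₂ : Fin L} (h : x₁ < x₂) {m n : ℕ} (hm : m = x₁ + (L - 1 - x₂))
    (hn : n = x₂ - x₁ - 1) :
    expect A (stringOp u R' R x₁ x₂) = κ ^ n *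
      ((((l : ℂ)⁻¹ • transfer A) ^ m * (opTransfer A R' * V⁻¹.val) *
        ((l : ℂ)⁻¹ • transfer A) ^ n * (V.val * opTransfer A R)).trace /
          (((l : ℂ)⁻¹ • transfer A) ^ (m + n + 2)).trace / l ^ 2) := by
  have hl' : (l : ℂ) ≠ 0 := by exact_mod_cast hl
  have hL : L = m + n + 2 := by have := x₂.isLt; omega
  have hT : transfer A = (l : ℂ) • ((l : ℂ)⁻¹ • transfer A) := (smul_inv_smul₀ hl' _).symm
  set t := (l : ℂ)⁻¹ • transfer A
  have hpow : opTransfer A u ^ n = (κ ^ n * l ^ n) • (V⁻¹.val * t ^ n * V.val) := by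
    rw [hu, hT, mul_smul_comm, smul_mul_assoc, smul_smul, smul_pow, Units.conj_pow', mul_pow]
  have hnum : (mpdo A L * stringOp u R' R x₁ x₂).trace = l ^ (m + n) *
      (κ ^ n * (t ^ m * (opTransfer A R' * V⁻¹.val) * t ^ n * (V.val * opTransfer A R)).trace) := by
    rw [trace_mpdo_mul_stringOp A u R' R h, ← hm, ← hn, hpow, hT, smul_pow]
    simp only [smul_mul_assoc, mul_smul_comm, smul_smul, Matrix.trace_smul, smul_eq_mul, mul_assoc]
    ring
  have hden : (mpdo A L).trace = l ^ (m + n) * (l ^ 2 * (t ^ (m + n + 2)).trace) := by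
    rw [trace_mpdo, hT, smul_pow, Matrix.trace_smul, hL, smul_eq_mul, pow_add _ (m + n) 2,
      mul_assoc]
  rw [expect, hnum, hden, mul_div_mul_left _ _ (pow_ne_zero _ hl'), mul_div_assoc, div_div,
    mul_comm ((l : ℂ) ^ 2)]

theorem expect_stringOp_tendsto {l : ℝ} {r s : Fin χ → ℂ} (hD : Dominant (transfer A) l r s)
    {κ : ℂ} (hκ : ‖κ‖ = 1) {V : GL (Fin χ) ℂ}
    (hu : opTransfer A u = κ • (V⁻¹.val * transfer A * V.val)) (R' R : Matrix (Fin d) (Fin d) ℂ) :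
    ∀ ε > 0, ∃ N : ℕ, ∀ (L : ℕ) (x₁ x₂ : Fin L), (x₁ : ℕ) + N ≤ x₂ → (x₂ : ℕ) + N ≤ L + x₁ →
      ‖expect A (stringOp u R' R x₁ x₂) - κ ^ (x₂ - x₁ - 1 : ℕ) * stringValue A l r s V R' R‖ <
        ε := by
  intro ε hε
  have hlim := (hD.tendsto_trace_pow_mul_pow_mul (opTransfer A R' * V⁻¹.val)
    (V.val * opTransfer A R)).div_const ((l : ℂ) ^ 2)
  rw [prod_atTop_atTop_eq] at hlim
  obtain ⟨⟨N₁, N₂⟩, hN⟩ := Metric.tendsto_atTop.1 hlim ε hε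
  refine ⟨N₁ + N₂ + 2, fun L x₁ x₂ hinner houter => ?_⟩
  rw [expect_stringOp hD.pos.ne' hu R' R (Fin.lt_def.2 (by omega)) rfl rfl, ← mul_sub, norm_mul,
    norm_pow, hκ, one_pow, one_mul, ← dist_eq_norm]
  exact hN (_, _) ⟨by simp only; omega, by simp only; omega⟩

theorem stringLimit_norm_stringValue {l : ℝ} {r s : Fin χ → ℂ} (hD : Dominant (transfer A) l r s)
    {κ : ℂ} (hκ : ‖κ‖ = 1) {V : GL (Fin χ) ℂ}
    (hu : opTransfer A u = κ • (V⁻¹.val * transfer A * V.val)) (R' R : Matrix (Fin d) (Fin d) ℂ) :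
    StringLimit A u R' R ‖stringValue A l r s V R' R‖ := by
  intro ε hε
  obtain ⟨N, hN⟩ := expect_stringOp_tendsto hD hκ hu R' R ε hε
  refine ⟨N, fun L x₁ x₂ hinner houter => lt_of_le_of_lt ?_ (hN L x₁ x₂ hinner houter)⟩
  have := abs_norm_sub_norm_le (expect A (stringOp u R' R x₁ x₂))
    (κ ^ (x₂ - x₁ - 1 : ℕ) * stringValue A l r s V R' R)
  rwa [norm_mul, norm_pow, hκ, one_pow, one_mul] at this

theorem StringLimit.unique {R' R : Matrix (Fin d) (Fin d) ℂ} {c c' : ℝ}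
    (h : StringLimit A u R' R c) (h' : StringLimit A u R' R c') : c = c' := by
  refine eq_of_forall_dist_le fun ε hε => ?_
  obtain ⟨N, hN⟩ := h _ (half_pos hε)
  obtain ⟨N', hN'⟩ := h' _ (half_pos hε)
  let x₁ : Fin (2 * (N + N') + 1) := ⟨0, by omega⟩
  let x₂ : Fin (2 * (N + N') + 1) := ⟨N + N', by omega⟩
  have hc := hN _ x₁ x₂ (by simp [x₁, x₂]) (by simp [x₁, x₂]; omega)
  have hc' := hN' _ x₁ x₂ (by simp [x₁, x₂]) (by simp [x₁, x₂]; omega)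
  rw [← Real.dist_eq] at hc hc'
  linarith [dist_triangle_left c c' ‖expect A (stringOp u R' R x₁ x₂)‖]

end StringExpectation

section GramPositivity

/-- The limiting Gram matrix of half-infinite strings with end points far apart from each other: its
entries are `m` on the diagonal, `C` above it and the conjugate of `C` below it. -/
noncomputable def gramEntry (m C : ℂ) (a b : ℕ) : ℂ :=
  if a = b then m else if a < b then C else starRingEnd ℂ C

theorem gramEntry_self (m C : ℂ) (a : ℕ) : gramEntry m C a a = m := if_pos rfl

theorem gramEntry_of_lt (m C : ℂ) {a b : ℕ} (h : a < b) : gramEntry m C a b = C := by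
  rw [gramEntry, if_neg h.ne, if_pos h]

theorem gramEntry_of_gt (m C : ℂ) {a b : ℕ} (h : b < a) :
    gramEntry m C a b = starRingEnd ℂ C := by
  rw [gramEntry, if_neg h.ne', if_neg h.not_gt]

theorem re_sum_gramEntry (m C : ℂ) (M : ℕ) :
    (∑ a ∈ Finset.range M, ∑ b ∈ Finset.range M, gramEntry m C a b).re =
      M * m.re + M * (M - 1) * C.re := by
  induction M with
  | zero => simp
  | succ M ih =>
    have hcol : ∑ a ∈ Finset.range M, gramEntry m C a M = M * C := by
      rw [Finset.sum_congr rfl fun a ha => gramEntry_of_lt m C (Finset.mem_range.1 ha),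
        Finset.sum_const, Finset.card_range, nsmul_eq_mul]
    have hrow : ∑ b ∈ Finset.range M, gramEntry m C M b = M * starRingEnd ℂ C := by
      rw [Finset.sum_congr rfl fun b hb => gramEntry_of_gt m C (Finset.mem_range.1 hb),
        Finset.sum_const, Finset.card_range, nsmul_eq_mul]
    simp only [Finset.sum_range_succ, Finset.sum_add_distrib, hcol, hrow, gramEntry_self,
      Complex.add_re, ih, Complex.mul_re, Complex.natCast_re, Complex.natCast_im, Complex.conj_re]
    push_cast
    ring

theorem re_sum_gramEntry_two_blocks (m C : ℂ) {z : ℂ} (hz : ‖z‖ = 1) (M : ℕ) :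
    (∑ a ∈ Finset.range (M + M), ∑ b ∈ Finset.range (M + M),
      starRingEnd ℂ (if a < M then 1 else z) * (if b < M then 1 else z) * gramEntry m C a b).re =
      2 * (M * m.re + M * (M - 1) * C.re) + 2 * (M ^ 2 * (z * C).re) := by
  have hin : ∀ a ∈ Finset.range M, (if a < M then 1 else z) = 1 :=
    fun a ha => if_pos (Finset.mem_range.1 ha)
  have hout : ∀ a, (if M + a < M then 1 else z) = z := fun a => if_neg (by omega)
  have hshift : ∀ a b, gramEntry m C (M + a) (M + b) = gramEntry m C a b := by simp [gramEntry]
  have hdiag : ∑ a ∈ Finset.range M, ∑ b ∈ Finset.range M, starRingEnd ℂ (if a < M then 1 else z) *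
      (if b < M then 1 else z) * gramEntry m C a b =
      ∑ a ∈ Finset.range M, ∑ b ∈ Finset.range M, gramEntry m C a b :=
    Finset.sum_congr rfl fun a ha => Finset.sum_congr rfl fun b hb => by
      rw [hin a ha, hin b hb, map_one, one_mul, one_mul]
  have hupper : ∑ a ∈ Finset.range M, ∑ b ∈ Finset.range M,
      starRingEnd ℂ (if a < M then 1 else z) * z * gramEntry m C a (M + b) =
      ∑ _ ∈ Finset.range M, ∑ _ ∈ Finset.range M, z * C :=
    Finset.sum_congr rfl fun a ha => Finset.sum_congr rfl fun b _ => by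
      rw [hin a ha, gramEntry_of_lt m C (by grind), map_one, one_mul]
  have hlower : ∑ a ∈ Finset.range M, ∑ b ∈ Finset.range M,
      starRingEnd ℂ z * (if b < M then 1 else z) * gramEntry m C (M + a) b =
      ∑ _ ∈ Finset.range M, ∑ _ ∈ Finset.range M, starRingEnd ℂ (z * C) :=
    Finset.sum_congr rfl fun a _ => Finset.sum_congr rfl fun b hb => by
      rw [hin b hb, gramEntry_of_gt m C (by grind), mul_one, map_mul]
  have hzz : starRingEnd ℂ z * z = 1 := by rw [Complex.conj_mul', hz, Complex.ofReal_one, one_pow]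
  simp only [Finset.sum_range_add _ M M, Finset.sum_add_distrib, hout, hshift, hzz, one_mul, hdiag,
    hupper, hlower, Complex.add_re, re_sum_gramEntry, Finset.sum_const, Finset.card_range,
    Complex.re_nsmul, Complex.conj_re]
  simp only [nsmul_eq_mul]
  ring

-- The quadratic form of the Gram matrix at `(1, …, 1, z, …, z)` grows like `Re C + Re (z C)`, and
-- `z C = -‖C‖` for a suitable phase `z`.
theorem nonneg_of_gramEntry {m C : ℂ}
    (h : ∀ (N : ℕ) (v : ℕ → ℂ), 0 ≤ (∑ a ∈ Finset.range N, ∑ b ∈ Finset.range N,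
      starRingEnd ℂ (v a) * v b * gramEntry m C a b).re) : 0 ≤ C := by
  rcases eq_or_ne C 0 with rfl | hC
  · rfl
  have hC' : ‖C‖ ≠ 0 := norm_ne_zero_iff.2 hC
  set z : ℂ := -(starRingEnd ℂ C / ‖C‖) with hz_def
  have hzC : z * C = ((-‖C‖ : ℝ) : ℂ) := by
    rw [hz_def, neg_mul, div_mul_eq_mul_div, Complex.conj_mul', sq, mul_div_assoc,
      div_self (Complex.ofReal_ne_zero.2 hC'), mul_one, Complex.ofReal_neg]
  have hz : ‖z‖ = 1 := by
    rw [hz_def, norm_neg, norm_div, Complex.norm_conj, Complex.norm_real, norm_norm, div_self hC']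
  have hgrowth : ∀ M : ℕ, 0 ≤ (m.re - ‖C‖) + M * (C.re - ‖C‖) := fun M => by
    have hform := h (M + 1 + (M + 1)) fun a => if a < M + 1 then 1 else z
    rw [re_sum_gramEntry_two_blocks m C hz, hzC, Complex.ofReal_re] at hform
    push_cast at hform
    refine nonneg_of_mul_nonneg_right (a := 2 * ((M : ℝ) + 1)) ?_ (by positivity)
    linarith
  refine Complex.re_eq_norm.1 (le_antisymm (Complex.re_le_norm C) ?_)
  by_contra! hlt
  obtain ⟨M, hM⟩ := exists_nat_gt ((m.re - ‖C‖) / (‖C‖ - C.re))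
  rw [div_lt_iff₀ (sub_pos.2 hlt)] at hM
  linarith [hgrowth M]

end GramPositivity

section HalfStrings

variable {d χ L : ℕ} {A : Tensor d χ} {u R : Matrix (Fin d) (Fin d) ℂ}

theorem expect_sum {ι : Type*} (t : Finset ι) (O : ι → ChainOp d L) :
    expect A (∑ i ∈ t, O i) = ∑ i ∈ t, expect A (O i) := by
  simp only [expect, Finset.mul_sum, Matrix.trace_sum, Finset.sum_div]

theorem expect_smul (c : ℂ) (O : ChainOp d L) : expect A (c • O) = c * expect A O := by
  simp only [expect, mul_smul_comm, Matrix.trace_smul, smul_eq_mul, mul_div_assoc]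

theorem expect_conjTranspose (hA : (mpdo A L).IsHermitian) (O : ChainOp d L) :
    expect A Oᴴ = starRingEnd ℂ (expect A O) := by
  have hnum : (mpdo A L * Oᴴ).trace = star (mpdo A L * O).trace := by
    rw [← Matrix.trace_conjTranspose, Matrix.conjTranspose_mul, hA.eq, Matrix.trace_mul_comm]
  have hden : (mpdo A L).trace = star (mpdo A L).trace := by
    rw [← Matrix.trace_conjTranspose, hA.eq]
  rw [expect, expect, hnum, starRingEnd_apply, star_div₀, ← hden]

theorem expect_conjTranspose_mul_self_nonneg (hA : (mpdo A L).PosSemidef) (O : ChainOp d L) :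
    0 ≤ expect A (Oᴴ * O) := by
  refine div_nonneg ?_ hA.trace_nonneg
  rw [← mul_assoc, Matrix.trace_mul_comm, ← mul_assoc]
  exact (hA.mul_mul_conjTranspose_same O).trace_nonneg

theorem re_sum_expect_nonneg {ι : Type*} [Fintype ι] (hA : (mpdo A L).PosSemidef)
    (O : ι → ChainOp d L) (v : ι → ℂ) :
    0 ≤ (∑ a, ∑ b, starRingEnd ℂ (v a) * v b * expect A ((O a)ᴴ * O b)).re := by
  have hnonneg := expect_conjTranspose_mul_self_nonneg hA (∑ a, v a • O a)
  simp only [Matrix.conjTranspose_sum, Matrix.conjTranspose_smul, Finset.sum_mul_sum, expect_sum,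
    smul_mul_smul_comm, expect_smul] at hnonneg
  exact (Complex.nonneg_iff.1 hnonneg).1

/-- The half-infinite string operator `(∏_{y < x} u(y)) R(x)`; a string operator with two end points
is the product of the adjoint of one such operator with another one. -/
noncomputable def halfString (u R : Matrix (Fin d) (Fin d) ℂ) (x : Fin L) : ChainOp d L :=
  siteProd fun y => if y < x then u else if y = x then R else 1

theorem conjTranspose_halfString_mul_of_lt (hu : uᴴ * u = 1) {x y : Fin L} (h : x < y) :
    (halfString u R x)ᴴ * halfString u R y = stringOp u (Rᴴ * u) R x y := by
  rw [halfString, halfString, siteProd_conjTranspose, siteProd_mul, stringOp]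
  congr 1
  funext z
  grind [Matrix.conjTranspose_one]

theorem conjTranspose_halfString_mul_self (hu : uᴴ * u = 1) (x y : Fin L) :
    (halfString u R x)ᴴ * halfString u R x = stringOp 1 (Rᴴ * R) 1 x y := by
  rw [halfString, siteProd_conjTranspose, siteProd_mul, stringOp]
  congr 1
  funext z
  grind [Matrix.conjTranspose_one]

/-- The first site of the `a`-th of `N` consecutive blocks of `n + 1` sites. -/
def blockSite {N : ℕ} (n : ℕ) (a : Fin N) : Fin (N * (n + 1)) := finProdFinEquiv (a, 0)

theorem blockSite_add_le {N n k : ℕ} (hk : k ≤ n + 1) {a b : Fin N} (h : a < b) :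
    (blockSite n a : ℕ) + k ≤ blockSite n b ∧
      (blockSite n b : ℕ) + k ≤ N * (n + 1) + blockSite n a := by
  have hval : ∀ c : Fin N, (blockSite n c : ℕ) = c * (n + 1) := fun c => by
    simp [blockSite, finProdFinEquiv, mul_comm]
  have hab : (a + 1 : ℕ) * (n + 1) ≤ b * (n + 1) := Nat.mul_le_mul_right _ h
  have hb : (b + 1 : ℕ) * (n + 1) ≤ N * (n + 1) := Nat.mul_le_mul_right _ b.isLt
  rw [hval, hval]
  constructor <;> nlinarith

theorem blockSite_lt {N : ℕ} (n : ℕ) {a b : Fin N} (h : a < b) : blockSite n a < blockSite n b :=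
  Nat.lt_of_succ_le (blockSite_add_le (Nat.le_add_left 1 n) h).1

variable {l : ℝ} {r s : Fin χ → ℂ} {V : GL (Fin χ) ℂ}

theorem tendsto_expect_stringOp_blockSite (hD : Dominant (transfer A) l r s)
    (hV : opTransfer A u = V⁻¹.val * transfer A * V.val) (R' R : Matrix (Fin d) (Fin d) ℂ)
    {N : ℕ} {a b : Fin N} (h : a < b) :
    Tendsto (fun n => expect A (stringOp u R' R (blockSite n a) (blockSite n b))) atTop
      (𝓝 (stringValue A l r s V R' R)) := by
  refine Metric.tendsto_atTop.2 fun ε hε => ?_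
  obtain ⟨k, hk⟩ :=
    expect_stringOp_tendsto hD norm_one (hV.trans (one_smul ℂ _).symm) R' R ε hε
  refine ⟨k, fun n hn => ?_⟩
  obtain ⟨hinner, houter⟩ := blockSite_add_le (hn.trans n.le_succ) h
  simpa only [dist_eq_norm, one_pow, one_mul] using hk _ _ _ hinner houter

theorem tendsto_expect_halfString (hA : ∀ L, (mpdo A L).IsHermitian)
    (hD : Dominant (transfer A) l r s) (hu : uᴴ * u = 1)
    (hV : opTransfer A u = V⁻¹.val * transfer A * V.val) {N : ℕ} (a b : Fin N) :
    Tendsto (fun n => expect A ((halfString u R (blockSite n a.castSucc))ᴴ *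
        halfString u R (blockSite n b.castSucc))) atTop
      (𝓝 (gramEntry (stringValue A l r s 1 (Rᴴ * R) 1)
        (stringValue A l r s V (Rᴴ * u) R) a b)) := by
  have hupper : ∀ {a b : Fin N}, a < b →
      Tendsto (fun n => expect A ((halfString u R (blockSite n a.castSucc))ᴴ *
        halfString u R (blockSite n b.castSucc))) atTop (𝓝 (stringValue A l r s V (Rᴴ * u) R)) :=
    fun h => by
    simp only [conjTranspose_halfString_mul_of_lt hu
      (blockSite_lt _ (Fin.castSucc_lt_castSucc_iff.2 h))]
    exact tendsto_expect_stringOp_blockSite hD hV (Rᴴ * u) R h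
  rcases lt_trichotomy a b with h | rfl | h
  · rw [gramEntry_of_lt _ _ h]
    exact hupper h
  · rw [gramEntry_self]
    simp only [conjTranspose_halfString_mul_self hu _ (blockSite _ a.succ)]
    exact tendsto_expect_stringOp_blockSite hD (by simp [opTransfer_one]) (Rᴴ * R) 1
      Fin.castSucc_lt_succ
  · rw [gramEntry_of_gt _ _ h]
    refine ((Complex.continuous_conj.tendsto _).comp (hupper h)).congr fun n => ?_
    rw [Function.comp_apply, ← expect_conjTranspose (hA _), Matrix.conjTranspose_mul,
      Matrix.conjTranspose_conjTranspose]

theorem stringValue_nonneg (hA : ∀ L, (mpdo A L).PosSemidef) (hD : Dominant (transfer A) l r s)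
    (hu : uᴴ * u = 1) (hV : opTransfer A u = V⁻¹.val * transfer A * V.val)
    (R : Matrix (Fin d) (Fin d) ℂ) : 0 ≤ stringValue A l r s V (Rᴴ * u) R := by
  refine nonneg_of_gramEntry (m := stringValue A l r s 1 (Rᴴ * R) 1) fun N v => ?_
  simp only [Finset.sum_range]
  refine ge_of_tendsto' ((Complex.continuous_re.tendsto _).comp (tendsto_finsetSum _ fun a _ =>
    tendsto_finsetSum _ fun b _ => (tendsto_expect_halfString (fun L => (hA L).isHermitian)
      hD hu hV a b).const_mul _)) fun n => ?_
  exact re_sum_expect_nonneg (hA _) (fun a : Fin N => halfString u R (blockSite n a.castSucc))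
    fun a => v a

end HalfStrings

theorem inv_slant {Γ : Type*} (ω : Γ → Γ → Circle) (x y : Γ) : (slant ω x y)⁻¹ = slant ω y x :=
  inv_div _ _

section TwoCocycle

variable {Γ M : Type*} [Group Γ] [CommGroup M] {σ : Γ →* ℤˣ}

/-- 2-cocycles of `Γ` with values in the multiplicative group `M`, on which `x` acts by
`m ↦ m ^ σ x`. For `M = Circle` this is complex conjugation if `σ x = -1`. -/
def IsTwoCocycle (σ : Γ →* ℤˣ) (ω : Γ → Γ → M) : Prop :=
  ∀ x y z, ω x y * ω (x * y) z = ω y z ^ (σ x : ℤ) * ω x (y * z)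

theorem IsTwoCocycle.mul_eq {ω : Γ → Γ → M} (h : IsTwoCocycle σ ω) {x : Γ} (hx : σ x = 1)
    (y z : Γ) : ω x y * ω (x * y) z = ω y z * ω x (y * z) := by
  rw [h, hx, Units.val_one, zpow_one]

variable {ω ω₁ ω₂ ω₃ : Γ → Γ → Circle} {x y z : Γ}

theorem IsTwoCocycle.slant_mul_right (h : IsTwoCocycle σ ω) (hx : σ x = 1) (hy : σ y = 1)
    (hxy : x * y = y * x) (hxz : x * z = z * x) :
    slant ω x (y * z) = slant ω x y * slant ω x z := by
  have h_yzx := eq_div_of_mul_eq'' (h.mul_eq hy z x)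
  have h_yxz := eq_div_of_mul_eq' (h.mul_eq hy x z).symm
  have h_xyz := eq_div_of_mul_eq'' (h.mul_eq hx y z).symm
  rw [hxz] at h_yxz
  rw [hxy] at h_xyz
  rw [slant, slant, slant, h_yzx, h_xyz, ← Additive.ofMul.injective.eq_iff]
  have h_add := congrArg Additive.ofMul h_yxz
  simp only [ofMul_mul, ofMul_div] at h_add ⊢
  rw [h_add]
  abel

theorem IsTwoCocycle.slant_mul_left (h : IsTwoCocycle σ ω) (hx : σ x = 1) (hz : σ z = 1)
    (hxz : x * z = z * x) (hyz : y * z = z * y) :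
    slant ω (x * y) z = slant ω x z * slant ω y z := by
  rw [← inv_slant ω z, h.slant_mul_right hz hx hxz.symm hyz.symm, mul_inv, inv_slant, inv_slant]

theorem IsTwoCocycle.slant_one_right (h : IsTwoCocycle σ ω) (hx : σ x = 1) : slant ω x 1 = 1 := by
  have h_sq := h.slant_mul_right (y := 1) (z := 1) hx (map_one σ) (by simp) (by simp)
  rw [mul_one] at h_sq
  exact left_eq_mul.1 h_sq

theorem Cohomologous.symm (h : Cohomologous σ ω₁ ω₂) : Cohomologous σ ω₂ ω₁ := by
  obtain ⟨φ, hφ⟩ := h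
  refine ⟨fun x => (φ x)⁻¹, fun x y => ?_⟩
  rw [hφ, inv_zpow, ← mul_inv, inv_div_inv, mul_assoc, div_mul_div_comm,
    mul_comm (φ x * _), div_self', mul_one]

theorem Cohomologous.trans (h : Cohomologous σ ω₁ ω₂) (h' : Cohomologous σ ω₂ ω₃) :
    Cohomologous σ ω₁ ω₃ := by
  obtain ⟨φ, hφ⟩ := h
  obtain ⟨ψ, hψ⟩ := h'
  refine ⟨fun x => φ x * ψ x, fun x y => ?_⟩
  rw [hψ, hφ, mul_zpow, mul_assoc, div_mul_div_comm, mul_mul_mul_comm]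

theorem Cohomologous.slant_eq (h : Cohomologous σ ω₁ ω₂) (hx : σ x = 1) (hy : σ y = 1)
    (hxy : x * y = y * x) : slant ω₁ x y = slant ω₂ x y := by
  obtain ⟨φ, hφ⟩ := h
  rw [slant, slant, hφ, hφ, hx, hy, hxy, Units.val_one, zpow_one, zpow_one,
    mul_comm (φ y) (φ x), mul_div_mul_right_eq_div]

end TwoCocycle

section ConjSign

/-- The action of a sign on the scalars: complex conjugation for `-1`. -/
noncomputable def conjSign (s : ℤˣ) : ℂ →+* ℂ := if s = 1 then RingHom.id ℂ else starRingEnd ℂ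

@[simp] theorem conjSign_one : conjSign 1 = RingHom.id ℂ := if_pos rfl

@[simp] theorem conjSign_neg_one : conjSign (-1) = starRingEnd ℂ := if_neg (by decide)

theorem conjSign_circle (s : ℤˣ) (z : Circle) : conjSign s z = ((z ^ (s : ℤ) : Circle) : ℂ) := by
  rcases Int.units_eq_one_or s with rfl | rfl
  · simp
  · simp [← Circle.coe_inv_eq_conj]

theorem circleExp_arg_mul {z w : ℂ} (hz : z ≠ 0) (hw : w ≠ 0) :
    Circle.exp (z * w).arg = Circle.exp z.arg * Circle.exp w.arg := by
  simp only [← Real.Angle.toCircle_coe, Complex.arg_mul_coe_angle hz hw, Real.Angle.toCircle_add]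

theorem circleExp_arg_conjSign (s : ℤˣ) (z : ℂ) :
    Circle.exp (conjSign s z).arg = Circle.exp z.arg ^ (s : ℤ) := by
  rcases Int.units_eq_one_or s with rfl | rfl
  · simp
  · simp only [conjSign_neg_one, ← Real.Angle.toCircle_coe, Complex.arg_conj_coe_angle,
      Real.Angle.toCircle_neg, Units.val_neg, Units.val_one, zpow_neg_one]

end ConjSign

section ProjectiveRep

variable {Γ E : Type*} [Group Γ] [AddCommGroup E] [Module ℂ E]

/-- A projective representation of `Γ` with multiplier `ω`, in which `x` acts linearly if
`σ x = 1` and antilinearly if `σ x = -1`. -/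
structure IsProjectiveRep (σ : Γ →* ℤˣ) (S : Γ → E → E) (ω : Γ → Γ → Circle) : Prop where
  map_smul : ∀ x (c : ℂ) v, S x (c • v) = conjSign (σ x) c • S x v
  map_mul : ∀ x y v, S x (S y v) = (ω x y : ℂ) • S (x * y) v
  map_one : ∀ v, S 1 v = (ω 1 1 : ℂ) • v

namespace IsProjectiveRep

variable {σ : Γ →* ℤˣ} {S : Γ → E → E} {ω : Γ → Γ → Circle}

theorem map_smul_of_linear (h : IsProjectiveRep σ S ω) {x : Γ} (hx : σ x = 1) (c : ℂ) (v : E) :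
    S x (c • v) = c • S x v := by
  rw [h.map_smul, hx, conjSign_one, RingHom.id_apply]

theorem apply_ne_zero (h : IsProjectiveRep σ S ω) (x : Γ) {v : E} (hv : v ≠ 0) : S x v ≠ 0 := by
  intro hxv
  have h_zero : S x⁻¹ 0 = 0 := by simpa using h.map_smul x⁻¹ 0 0
  have h_inv := h.map_mul x⁻¹ x v
  rw [hxv, h_zero, inv_mul_cancel, h.map_one] at h_inv
  exact smul_ne_zero (Circle.coe_ne_zero _) (smul_ne_zero (Circle.coe_ne_zero _) hv) h_inv.symm

theorem isTwoCocycle (h : IsProjectiveRep σ S ω) {v : E} (hv : v ≠ 0) : IsTwoCocycle σ ω := by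
  intro x y z
  refine Circle.ext (smul_left_injective ℂ (h.apply_ne_zero (x * y * z) hv) ?_)
  calc ((ω x y * ω (x * y) z : Circle) : ℂ) • S (x * y * z) v = S x (S y (S z v)) := by
        rw [h.map_mul x y, h.map_mul, smul_smul, Circle.coe_mul]
    _ = ((ω y z ^ (σ x : ℤ) * ω x (y * z) : Circle) : ℂ) • S (x * y * z) v := by
        rw [h.map_mul y z, h.map_smul, h.map_mul, conjSign_circle, smul_smul, Circle.coe_mul,
          mul_assoc x y z]

theorem apply_apply_eq_slant_smul (h : IsProjectiveRep σ S ω) {x y : Γ} (hxy : x * y = y * x)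
    (v : E) : S y (S x v) = (slant ω x y : ℂ) • S x (S y v) := by
  rw [h.map_mul, h.map_mul, smul_smul, ← Circle.coe_mul, slant, div_mul_cancel, hxy]

end IsProjectiveRep

end ProjectiveRep

section DoubledGroup

variable {G K : Type*} [Group G] [Group K]

/-- The element `(e, h, e)` of the doubled group. -/
def braElt (K : Type*) [Group K] {G : Type*} [Group G] (h : G) : DoubledGroup G K :=
  SemidirectProduct.inl (1, h, 1)

/-- The diagonal element `(s, s, k)`, acting on operators by conjugation with `U_s W_k`. -/
def diagElt (p : G × K) : DoubledGroup G K := SemidirectProduct.inl (p.1, p.1, p.2)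

/-- The Hermiticity symmetry as an element of the doubled group. -/
def hermElt (G K : Type*) [Group G] [Group K] : DoubledGroup G K := SemidirectProduct.inr (-1)

theorem antiSign_ketElt (p : G × K) : antiSign G K (ketElt p) = 1 := rfl

theorem antiSign_braElt (h : G) : antiSign G K (braElt K h) = 1 := rfl

theorem antiSign_diagElt (p : G × K) : antiSign G K (diagElt p) = 1 := rfl

theorem antiSign_hermElt : antiSign G K (hermElt G K) = -1 := rfl

theorem hermAction_neg_one (n : G × G × K) : hermAction G K (-1) n = (n.2.1, n.1, n.2.2) := by
  simp [hermAction, swapAut]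

theorem ketElt_mul (p q : G × K) : ketElt (p * q) = ketElt p * ketElt q := by
  simp only [ketElt, ← map_mul, Prod.fst_mul, Prod.snd_mul, Prod.mk_mul_mk, mul_one]

theorem ketElt_one : ketElt (1 : G × K) = 1 := map_one SemidirectProduct.inl

theorem ketElt_comm {p q : G × K} (h : p * q = q * p) :
    ketElt p * ketElt q = ketElt q * ketElt p := by
  rw [← ketElt_mul, ← ketElt_mul, h]

theorem ketElt_comm_of_strong {g : G} {p : G × K} (h : g * p.1 = p.1 * g) :
    ketElt (g, 1) * ketElt p = ketElt p * ketElt (g, 1) :=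
  ketElt_comm (Prod.ext h (by simp))

theorem ketElt_mul_braElt (p : G × K) : ketElt p * braElt K p.1 = diagElt p := by
  simp [ketElt, braElt, diagElt, ← map_mul]

theorem ketElt_braElt_comm (p : G × K) (h : G) :
    ketElt p * braElt K h = braElt K h * ketElt p := by
  simp [ketElt, braElt, ← map_mul]

theorem ketElt_diagElt_comm {g : G} {p : G × K} (h : g * p.1 = p.1 * g) :
    ketElt (g, 1) * diagElt p = diagElt p * ketElt (g, 1) := by
  rw [← ketElt_mul_braElt, ← mul_assoc, ketElt_comm_of_strong h, mul_assoc, ketElt_braElt_comm,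
    mul_assoc]

theorem hermElt_mul_self : hermElt G K * hermElt G K = 1 := by
  rw [hermElt, ← map_mul]; simp

theorem hermElt_mul_inl (g h : G) (k : K) :
    hermElt G K * SemidirectProduct.inl (g, h, k) =
      SemidirectProduct.inl (h, g, k) * hermElt G K := by
  rw [← hermAction_neg_one (g, h, k), SemidirectProduct.inl_aut, hermElt,
    mul_assoc _ _ (SemidirectProduct.inr (-1)), ← map_mul, inv_mul_cancel, map_one, mul_one]

theorem hermElt_ketElt_hermElt (g : G) :
    hermElt G K * (ketElt (g, 1) * hermElt G K) = braElt K g := by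
  rw [← mul_assoc, ketElt, hermElt_mul_inl, mul_assoc, hermElt_mul_self, mul_one, braElt]

theorem hermElt_ketElt_hermElt_ketElt (g : G) :
    hermElt G K * (ketElt (g, 1) * (hermElt G K * ketElt (g, 1))) = diagElt (g, 1) := by
  rw [← mul_assoc (ketElt _), ← mul_assoc, hermElt_ketElt_hermElt, ← ketElt_braElt_comm,
    ketElt_mul_braElt]

theorem hermElt_mul_ketElt_one (k : K) :
    hermElt G K * ketElt (1, k) = ketElt (1, k) * hermElt G K := by
  rw [ketElt, hermElt_mul_inl]

end DoubledGroup

section PositiveRep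

variable {G K E : Type*} [Group G] [Group K] [AddCommGroup E] [Module ℂ E]

/-- A projective representation of the doubled group with a common eigenvector `r` of the weak and
the Hermiticity symmetry on which the ket copy of every `g` and its conjugate under the Hermiticity
symmetry multiply to a positive scalar. For an MPDO, `r` is the leading eigenvector of the transfer
matrix, and the positivity comes from that of the state. -/
structure PositiveRep (S : DoubledGroup G K → E → E)
    (ω : DoubledGroup G K → DoubledGroup G K → Circle) (r : E) : Prop
    extends IsProjectiveRep (antiSign G K) S ω where
  ne_zero : r ≠ 0
  weak_eigen : ∀ k, ∃ c : ℂ, c ≠ 0 ∧ S (ketElt (1, k)) r = c • r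
  herm_eigen : ∃ c : ℂ, c ≠ 0 ∧ S (hermElt G K) r = c • r
  pos : ∀ g, ∃ t : ℝ, 0 < t ∧
    S (hermElt G K) (S (ketElt (g, 1)) (S (hermElt G K) (S (ketElt (g, 1)) r))) = (t : ℂ) • r

theorem eq_of_forall_eq_smul {r : E} (hr : r ≠ 0) {F F' : E → E} (hF : F r = r) (hF' : F' r = r)
    {e : ℂ} (he : ∀ v, F v = e • F' v) (v : E) : F v = F' v := by
  have h_one : e = 1 := smul_left_injective ℂ hr <| by
    simpa only [hF, hF', one_smul] using (he r).symm
  rw [he, h_one, one_smul]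

namespace PositiveRep

variable {S : DoubledGroup G K → E → E} {ω : DoubledGroup G K → DoubledGroup G K → Circle} {r : E}

theorem ket_smul (h : PositiveRep S ω r) (p : G × K) (c : ℂ) (v : E) :
    S (ketElt p) (c • v) = c • S (ketElt p) v :=
  h.map_smul_of_linear (antiSign_ketElt p) c v

theorem herm_smul (h : PositiveRep S ω r) (c : ℂ) (v : E) :
    S (hermElt G K) (c • v) = starRingEnd ℂ c • S (hermElt G K) v := by
  rw [h.map_smul, antiSign_hermElt, conjSign_neg_one]

theorem ket_ket (h : PositiveRep S ω r) (g g' : G) (v : E) :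
    S (ketElt (g, 1)) (S (ketElt (g', 1)) v) =
      (ketCocycle ω g g' : ℂ) • S (ketElt (g * g', 1)) v := by
  rw [h.map_mul, ← ketElt_mul, ketCocycle, Prod.mk_mul_mk, mul_one]

/-- The eigenvalue of the Hermiticity symmetry on the distinguished vector. -/
noncomputable def hermScalar (h : PositiveRep S ω r) : ℂ := h.herm_eigen.choose

theorem hermScalar_ne_zero (h : PositiveRep S ω r) : h.hermScalar ≠ 0 :=
  h.herm_eigen.choose_spec.1

theorem herm_self (h : PositiveRep S ω r) : S (hermElt G K) r = h.hermScalar • r :=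
  h.herm_eigen.choose_spec.2

/-- The Hermiticity symmetry normalized to fix the distinguished vector. -/
noncomputable def theta (h : PositiveRep S ω r) (v : E) : E :=
  h.hermScalar⁻¹ • S (hermElt G K) v

theorem theta_smul (h : PositiveRep S ω r) (c : ℂ) (v : E) :
    h.theta (c • v) = starRingEnd ℂ c • h.theta v := by
  rw [theta, h.herm_smul, theta, smul_comm]

theorem theta_self (h : PositiveRep S ω r) : h.theta r = r := by
  rw [theta, h.herm_self, smul_smul, inv_mul_cancel₀ h.hermScalar_ne_zero, one_smul]

theorem theta_theta (h : PositiveRep S ω r) (v : E) : h.theta (h.theta v) = v := by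
  refine eq_of_forall_eq_smul h.ne_zero (F := fun v => h.theta (h.theta v)) (F' := id)
    (by simp only [h.theta_self]) rfl (e := h.hermScalar⁻¹ * starRingEnd ℂ h.hermScalar⁻¹ *
      (ω (hermElt G K) (hermElt G K) * ω 1 1)) (fun v => ?_) v
  simp only [theta, h.herm_smul, h.map_mul, hermElt_mul_self, h.map_one, smul_smul, id, mul_assoc]

/-- The copy of `g` on the bra side, obtained from the one on the ket side by the Hermiticity
symmetry. -/
noncomputable def bra (h : PositiveRep S ω r) (g : G) (v : E) : E :=
  h.theta (S (ketElt (g, 1)) (h.theta v))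

theorem theta_ket (h : PositiveRep S ω r) (g : G) (v : E) :
    h.theta (S (ketElt (g, 1)) v) = h.bra g (h.theta v) := by
  rw [bra, h.theta_theta]

theorem theta_bra (h : PositiveRep S ω r) (g : G) (v : E) :
    h.theta (h.bra g v) = S (ketElt (g, 1)) (h.theta v) := by
  rw [bra, h.theta_theta]

theorem bra_smul (h : PositiveRep S ω r) (g : G) (c : ℂ) (v : E) :
    h.bra g (c • v) = c • h.bra g v := by
  simp only [bra, h.theta_smul, h.ket_smul, Complex.conj_conj]

theorem bra_bra (h : PositiveRep S ω r) (g g' : G) (v : E) :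
    h.bra g (h.bra g' v) = (((ketCocycle ω g g')⁻¹ : Circle) : ℂ) • h.bra (g * g') v := by
  rw [bra, bra, bra, h.theta_theta, h.ket_ket, h.theta_smul, Circle.coe_inv_eq_conj]

theorem exists_bra_eq (h : PositiveRep S ω r) (g : G) :
    ∃ c : ℂ, c ≠ 0 ∧ ∀ v, h.bra g v = c • S (braElt K g) v := by
  refine ⟨h.hermScalar⁻¹ * starRingEnd ℂ h.hermScalar⁻¹ *
    (starRingEnd ℂ (ω (ketElt (g, 1)) (hermElt G K)) *
      ω (hermElt G K) (ketElt (g, 1) * hermElt G K)), ?_, fun v => ?_⟩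
  · simp [h.hermScalar_ne_zero]
  · simp only [bra, theta, h.ket_smul, h.herm_smul, h.map_mul, hermElt_ketElt_hermElt, smul_smul,
      map_mul, mul_assoc]

theorem exists_bra_ket_self (h : PositiveRep S ω r) (g : G) :
    ∃ t : ℝ, 0 < t ∧ h.bra g (S (ketElt (g, 1)) r) = (t : ℂ) • r := by
  obtain ⟨t, ht, h_pos⟩ := h.pos g
  have h_norm := norm_pos_iff.2 h.hermScalar_ne_zero
  refine ⟨(‖h.hermScalar‖ ^ 2)⁻¹ * t, by positivity, ?_⟩
  rw [bra, theta, theta, h.ket_smul, h.herm_smul, h_pos, smul_smul, smul_smul, map_inv₀,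
    ← mul_inv, Complex.mul_conj']
  push_cast
  rfl

/-- Positivity enters here: the commutator of the two copies is a phase, and comparing the positive
scalars of `g`, `g'` and `g * g'` makes it positive. -/
theorem slant_ket_bra (h : PositiveRep S ω r) (g g' : G) :
    slant ω (ketElt (g, 1)) (braElt K g') = 1 := by
  set b : Circle := slant ω (ketElt (g, 1)) (braElt K g')
  have h_comm (v : E) :
      h.bra g' (S (ketElt (g, 1)) v) = (b : ℂ) • S (ketElt (g, 1)) (h.bra g' v) := by
    obtain ⟨c, -, hc⟩ := h.exists_bra_eq g'
    rw [hc, hc, h.ket_smul, h.apply_apply_eq_slant_smul (ketElt_braElt_comm _ _), smul_comm]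
  obtain ⟨t, ht, hg⟩ := h.exists_bra_ket_self g
  obtain ⟨t', ht', hg'⟩ := h.exists_bra_ket_self g'
  obtain ⟨t'', ht'', hgg'⟩ := h.exists_bra_ket_self (g * g')
  have h_two_ways : ((b : ℂ) * (t' * t : ℝ)) • r = (t'' : ℂ) • r := by
    calc ((b : ℂ) * (t' * t : ℝ)) • r
        = h.bra g (h.bra g' (S (ketElt (g, 1)) (S (ketElt (g', 1)) r))) := by
          rw [h_comm, hg', h.ket_smul, h.bra_smul, h.bra_smul, hg, smul_smul, smul_smul,
            Complex.ofReal_mul, mul_assoc]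
      _ = (t'' : ℂ) • r := by
          rw [h.ket_ket, h.bra_smul, h.bra_smul, h.bra_bra, smul_smul, ← Circle.coe_mul,
            mul_inv_cancel, Circle.coe_one, one_smul, hgg']
  have h_phase : (b : ℂ) * (t' * t : ℝ) = t'' := smul_left_injective ℂ h.ne_zero h_two_ways
  have h_norm : t' * t = t'' := by
    have := congrArg norm h_phase
    rwa [norm_mul, Circle.norm_coe, one_mul, Complex.norm_of_nonneg (by positivity),
      Complex.norm_of_nonneg ht''.le] at this
  rw [h_norm] at h_phase
  exact Circle.ext (by simpa [ht''.ne'] using h_phase)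

theorem bra_ket (h : PositiveRep S ω r) (g g' : G) (v : E) :
    h.bra g' (S (ketElt (g, 1)) v) = S (ketElt (g, 1)) (h.bra g' v) := by
  obtain ⟨c, -, hc⟩ := h.exists_bra_eq g'
  rw [hc, hc, h.ket_smul, h.apply_apply_eq_slant_smul (ketElt_braElt_comm _ _), h.slant_ket_bra,
    Circle.coe_one, one_smul]

theorem slant_diagElt (h : PositiveRep S ω r) {g : G} {p : G × K} (hgp : g * p.1 = p.1 * g) :
    slant ω (ketElt (g, 1)) (diagElt p) = slant ω (ketElt (g, 1)) (ketElt p) := by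
  rw [← ketElt_mul_braElt, (h.isTwoCocycle h.ne_zero).slant_mul_right rfl rfl
    (ketElt_comm_of_strong hgp) (ketElt_braElt_comm _ _), h.slant_ket_bra, mul_one]

/-- The eigenvalue of the weak symmetry `k` on the distinguished vector. -/
noncomputable def weakScalar (h : PositiveRep S ω r) (k : K) : ℂ := (h.weak_eigen k).choose

theorem weakScalar_ne_zero (h : PositiveRep S ω r) (k : K) : h.weakScalar k ≠ 0 :=
  (h.weak_eigen k).choose_spec.1

theorem ket_weak_self (h : PositiveRep S ω r) (k : K) :
    S (ketElt (1, k)) r = h.weakScalar k • r :=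
  (h.weak_eigen k).choose_spec.2

/-- The weak symmetry normalized to fix the distinguished vector. -/
noncomputable def weak (h : PositiveRep S ω r) (k : K) (v : E) : E :=
  (h.weakScalar k)⁻¹ • S (ketElt (1, k)) v

theorem weak_smul (h : PositiveRep S ω r) (k : K) (c : ℂ) (v : E) :
    h.weak k (c • v) = c • h.weak k v := by
  rw [weak, h.ket_smul, weak, smul_comm]

theorem weak_self (h : PositiveRep S ω r) (k : K) : h.weak k r = r := by
  rw [weak, h.ket_weak_self, smul_smul, inv_mul_cancel₀ (h.weakScalar_ne_zero k), one_smul]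

theorem ket_eq_weak (h : PositiveRep S ω r) (k : K) (v : E) :
    S (ketElt (1, k)) v = h.weakScalar k • h.weak k v := by
  rw [weak, smul_smul, mul_inv_cancel₀ (h.weakScalar_ne_zero k), one_smul]

theorem weak_weak (h : PositiveRep S ω r) (k k' : K) (v : E) :
    h.weak k (h.weak k' v) = h.weak (k * k') v := by
  refine eq_of_forall_eq_smul h.ne_zero (F := fun v => h.weak k (h.weak k' v))
    (F' := h.weak (k * k')) (by simp only [h.weak_self]) (h.weak_self _)
    (e := (h.weakScalar k)⁻¹ * ((h.weakScalar k')⁻¹ * (ω (ketElt (1, k)) (ketElt (1, k')) *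
      h.weakScalar (k * k')))) (fun v => ?_) v
  have h_mul : (ketElt (1, k) * ketElt (1, k') : DoubledGroup G K) = ketElt (1, k * k') := by
    rw [← ketElt_mul, Prod.mk_mul_mk, one_mul]
  rw [weak, weak, h.ket_smul, h.map_mul, h_mul, h.ket_eq_weak, smul_smul, smul_smul, smul_smul,
    mul_assoc, mul_assoc]

theorem theta_weak (h : PositiveRep S ω r) (k : K) (v : E) :
    h.theta (h.weak k v) = h.weak k (h.theta v) := by
  have h_comm (v : E) : S (hermElt G K) (S (ketElt (1, k)) v) =
      (slant ω (ketElt (1, k)) (hermElt G K) : ℂ) • S (ketElt (1, k)) (S (hermElt G K) v) :=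
    h.apply_apply_eq_slant_smul (hermElt_mul_ketElt_one k).symm v
  refine eq_of_forall_eq_smul h.ne_zero (F := fun v => h.theta (h.weak k v))
    (F' := fun v => h.weak k (h.theta v)) (by simp only [h.theta_self, h.weak_self])
    (by simp only [h.theta_self, h.weak_self])
    (e := starRingEnd ℂ (h.weakScalar k)⁻¹ *
      slant ω (ketElt (1, k)) (hermElt G K) * h.weakScalar k) (fun v => ?_) v
  rw [weak, h.theta_smul, theta, h_comm, h.ket_eq_weak, theta, h.weak_smul, smul_smul, smul_smul,
    smul_smul, smul_smul]
  congr 1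
  ring

end PositiveRep

end PositiveRep

section NormalForm

variable {G K E : Type*} [Group G] [Group K] [AddCommGroup E] [Module ℂ E]

/-- The slant product of a cocycle of the doubled group restricted to the strong symmetry on the ket
side and the weak symmetry. -/
noncomputable def pairing (ω : DoubledGroup G K → DoubledGroup G K → Circle) (g : G) (k : K) :
    Circle :=
  slant ω (ketElt (g, 1)) (ketElt (1, k))

/-- The cocycle of the doubled group built from a cocycle `c` of `G` and a pairing `b` of `G` and
`K`: its bra copy is the complex conjugate of its ket copy. -/
noncomputable def normalCocycle (c : G → G → Circle) (b : G → K → Circle)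
    (x y : DoubledGroup G K) : Circle :=
  b (hermAction G K x.right y.left).1 x.left.2.2 *
    (b (hermAction G K x.right y.left).2.1 x.left.2.2)⁻¹ *
    (c x.left.1 (hermAction G K x.right y.left).1 *
      (c x.left.2.1 (hermAction G K x.right y.left).2.1)⁻¹)

theorem hermAction_div_zpow (f : G → Circle) (s : ℤˣ) (n : G × G × K) :
    f (hermAction G K s n).1 / f (hermAction G K s n).2.1 = (f n.1 / f n.2.1) ^ (s : ℤ) := by
  rcases Int.units_eq_one_or s with rfl | rfl
  · simp
  · simp [hermAction_neg_one]

theorem cohomologous_normalCocycle_of_cohomologous {c₁ c₂ : G → G → Circle} (b : G → K → Circle)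
    (h : Cohomologous 1 c₁ c₂) :
    Cohomologous (antiSign G K) (normalCocycle c₁ b) (normalCocycle c₂ b) := by
  obtain ⟨f, hf⟩ := h
  refine ⟨fun x => f x.left.1 / f x.left.2.1, fun x y => ?_⟩
  simp only [MonoidHom.one_apply, Units.val_one, zpow_one] at hf
  simp only [normalCocycle, hf, SemidirectProduct.rightHom_eq_right, SemidirectProduct.mul_left,
    Prod.fst_mul, Prod.snd_mul, ← hermAction_div_zpow]
  rw [← Additive.ofMul.injective.eq_iff]
  simp only [ofMul_mul, ofMul_div, ofMul_inv]
  abel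

namespace PositiveRep

variable {S : DoubledGroup G K → E → E} {ω : DoubledGroup G K → DoubledGroup G K → Circle} {r : E}

theorem weak_ket (h : PositiveRep S ω r) (k : K) (g : G) (v : E) :
    h.weak k (S (ketElt (g, 1)) v) = (pairing ω g k : ℂ) • S (ketElt (g, 1)) (h.weak k v) := by
  have h_comm : ketElt (g, (1 : K)) * ketElt (1, k) = ketElt (1, k) * ketElt (g, 1) :=
    ketElt_comm (by simp)
  rw [weak, h.apply_apply_eq_slant_smul h_comm, weak, h.ket_smul, smul_comm, pairing]

theorem weak_bra (h : PositiveRep S ω r) (k : K) (g : G) (v : E) :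
    h.weak k (h.bra g v) = (((pairing ω g k)⁻¹ : Circle) : ℂ) • h.bra g (h.weak k v) := by
  rw [bra, ← h.theta_weak, h.weak_ket, h.theta_smul, ← h.theta_weak k v,
    Circle.coe_inv_eq_conj, bra]

/-- The power of the normalized Hermiticity symmetry given by a sign. -/
noncomputable def thetaPow (h : PositiveRep S ω r) (s : ℤˣ) (v : E) : E :=
  if s = 1 then v else h.theta v

/-- The representation of `G × G × K` in which the Hermiticity symmetry exchanges the two copies of
`G` without a further phase. -/
noncomputable def unitaryPart (h : PositiveRep S ω r) (n : G × G × K) (v : E) : E :=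
  S (ketElt (n.1, 1)) (h.bra n.2.1 (h.weak n.2.2 v))

/-- The representation `S`, rescaled so that its cocycle is a `normalCocycle`. -/
noncomputable def normalRep (h : PositiveRep S ω r) (x : DoubledGroup G K) (v : E) : E :=
  h.unitaryPart x.left (h.thetaPow x.right v)

theorem thetaPow_one (h : PositiveRep S ω r) (v : E) : h.thetaPow 1 v = v := if_pos rfl

theorem thetaPow_neg_one (h : PositiveRep S ω r) (v : E) : h.thetaPow (-1) v = h.theta v :=
  if_neg (by decide)

theorem thetaPow_thetaPow (h : PositiveRep S ω r) (s t : ℤˣ) (v : E) :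
    h.thetaPow s (h.thetaPow t v) = h.thetaPow (s * t) v := by
  rcases Int.units_eq_one_or s with rfl | rfl <;> rcases Int.units_eq_one_or t with rfl | rfl <;>
    simp [thetaPow_one, thetaPow_neg_one, h.theta_theta]

theorem thetaPow_unitaryPart (h : PositiveRep S ω r) (s : ℤˣ) (n : G × G × K) (v : E) :
    h.thetaPow s (h.unitaryPart n v) = h.unitaryPart (hermAction G K s n) (h.thetaPow s v) := by
  rcases Int.units_eq_one_or s with rfl | rfl
  · simp [thetaPow_one]
  · rw [hermAction_neg_one, thetaPow_neg_one, thetaPow_neg_one, unitaryPart, unitaryPart,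
      h.theta_ket, h.theta_bra, h.theta_weak, h.bra_ket]

theorem unitaryPart_unitaryPart (h : PositiveRep S ω r) (n m : G × G × K) (v : E) :
    h.unitaryPart n (h.unitaryPart m v) =
      ((pairing ω m.1 n.2.2 * (pairing ω m.2.1 n.2.2)⁻¹ *
        (ketCocycle ω n.1 m.1 * (ketCocycle ω n.2.1 m.2.1)⁻¹) : Circle) : ℂ) •
        h.unitaryPart (n * m) v := by
  simp only [unitaryPart, h.weak_ket, h.weak_bra, h.bra_smul, h.ket_smul, h.bra_ket, h.bra_bra,
    h.ket_ket, h.weak_weak, smul_smul, Prod.fst_mul, Prod.snd_mul]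
  congr 1
  simp only [Circle.coe_mul]
  ring

theorem normalRep_normalRep (h : PositiveRep S ω r) (x y : DoubledGroup G K) (v : E) :
    h.normalRep x (h.normalRep y v) =
      (normalCocycle (ketCocycle ω) (pairing ω) x y : ℂ) • h.normalRep (x * y) v := by
  rw [normalRep, normalRep, h.thetaPow_unitaryPart, h.unitaryPart_unitaryPart, h.thetaPow_thetaPow]
  rfl

theorem exists_thetaPow_eq (h : PositiveRep S ω r) (s : ℤˣ) :
    ∃ c : ℂ, c ≠ 0 ∧ ∀ v, h.thetaPow s v = c • S (SemidirectProduct.inr s) v := by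
  rcases Int.units_eq_one_or s with rfl | rfl
  · refine ⟨(ω 1 1 : ℂ)⁻¹, inv_ne_zero (Circle.coe_ne_zero _), fun v => ?_⟩
    rw [thetaPow_one, _root_.map_one, h.map_one, smul_smul,
      inv_mul_cancel₀ (Circle.coe_ne_zero _), one_smul]
  · exact ⟨h.hermScalar⁻¹, inv_ne_zero h.hermScalar_ne_zero, h.thetaPow_neg_one⟩

theorem exists_normalRep_eq (h : PositiveRep S ω r) (x : DoubledGroup G K) :
    ∃ c : ℂ, c ≠ 0 ∧ ∀ v, h.normalRep x v = c • S x v := by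
  obtain ⟨n, s⟩ := x
  obtain ⟨a, ha, h_theta⟩ := h.exists_thetaPow_eq s
  obtain ⟨b, hb, h_bra⟩ := h.exists_bra_eq n.2.1
  have h_factor : (⟨n, s⟩ : DoubledGroup G K) =
      ketElt (n.1, 1) * (braElt K n.2.1 * (ketElt (1, n.2.2) * SemidirectProduct.inr s)) := by
    rw [SemidirectProduct.mk_eq_inl_mul_inr, ketElt, ketElt, braElt, ← mul_assoc, ← mul_assoc,
      ← _root_.map_mul, ← _root_.map_mul]
    simp
  refine ⟨b * ((h.weakScalar n.2.2)⁻¹ * (a * (ω (ketElt (1, n.2.2)) (SemidirectProduct.inr s) *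
    (ω (braElt K n.2.1) (ketElt (1, n.2.2) * SemidirectProduct.inr s) * ω (ketElt (n.1, 1))
      (braElt K n.2.1 * (ketElt (1, n.2.2) * SemidirectProduct.inr s)))))), ?_, fun v => ?_⟩
  · simp [ha, hb, h.weakScalar_ne_zero]
  · simp only [normalRep, unitaryPart, weak, h_theta, h_bra, h_factor, h.ket_smul, h.map_mul,
      h.map_smul_of_linear (antiSign_braElt _), smul_smul, mul_assoc]

theorem cohomologous_normalCocycle (h : PositiveRep S ω r) :
    Cohomologous (antiSign G K) (normalCocycle (ketCocycle ω) (pairing ω)) ω := by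
  choose c hc_ne hc using h.exists_normalRep_eq
  refine ⟨fun x => Circle.exp (c x).arg, fun x y => ?_⟩
  set η := normalCocycle (ketCocycle ω) (pairing ω) x y
  have h_scalar : c x * (conjSign (antiSign G K x) (c y) * ω x y) = η * c (x * y) := by
    refine smul_left_injective ℂ (h.apply_ne_zero (x * y) h.ne_zero) ?_
    simp only [mul_smul]
    rw [← hc (x * y), ← h.normalRep_normalRep, ← h.map_mul, ← h.map_smul, ← hc, ← hc]
  have h_phase := congrArg (fun z : ℂ => Circle.exp z.arg) h_scalar
  rw [circleExp_arg_mul (hc_ne x) (by simp [hc_ne]), circleExp_arg_mul (by simp [hc_ne]) (by simp),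
    circleExp_arg_mul (by simp) (hc_ne _), circleExp_arg_conjSign, Circle.exp_arg,
    Circle.exp_arg, ← mul_assoc] at h_phase
  rw [← mul_div_assoc, ← h_phase, mul_div_cancel_left]

end PositiveRep

end NormalForm

section VirtualAction

variable {G K : Type*} [Group G] [Group K] {n : ℕ}

/-- The action of the doubled group on the virtual space by the matrices `V x`, preceded by complex
conjugation for anti-unitary `x`. -/
noncomputable def virtualAct (V : DoubledGroup G K → GL (Fin n) ℂ) (x : DoubledGroup G K)
    (v : Fin n → ℂ) : Fin n → ℂ :=
  (V x).val *ᵥ fun i => conjSign (antiSign G K x) (v i)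

variable (V : DoubledGroup G K → GL (Fin n) ℂ)

theorem virtualAct_of_linear {x : DoubledGroup G K} (hx : antiSign G K x = 1) (v : Fin n → ℂ) :
    virtualAct V x v = (V x).val *ᵥ v := by
  simp [virtualAct, hx]

theorem virtualAct_hermElt (v : Fin n → ℂ) :
    virtualAct V (hermElt G K) v = (V (hermElt G K)).val *ᵥ star v := by
  rw [virtualAct, antiSign_hermElt, conjSign_neg_one]
  rfl

theorem virtualAct_smul (x : DoubledGroup G K) (c : ℂ) (v : Fin n → ℂ) :
    virtualAct V x (c • v) = conjSign (antiSign G K x) c • virtualAct V x v := by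
  rw [virtualAct, virtualAct, ← Matrix.mulVec_smul]
  congr 1
  ext i
  simp

theorem virtualAct_injective (x : DoubledGroup G K) : Function.Injective (virtualAct V x) := by
  intro v w hvw
  have h_entries := congrArg ((V x)⁻¹.val *ᵥ ·) hvw
  simp only [virtualAct, Matrix.mulVec_mulVec, Units.inv_mul, Matrix.one_mulVec] at h_entries
  ext i
  exact (conjSign (antiSign G K x)).injective (congrFun h_entries i)

theorem conjSign_virtualAct (x y : DoubledGroup G K) (v : Fin n → ℂ) :
    (fun i => conjSign (antiSign G K x) (virtualAct V y v i)) =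
      (twist x (V y)).val *ᵥ fun i => conjSign (antiSign G K (x * y)) (v i) := by
  rw [map_mul, twist]
  rcases Int.units_eq_one_or (antiSign G K x) with hx | hx
  · simp [hx, virtualAct]
  · rw [hx, if_neg (by decide)]
    ext i
    simp only [virtualAct, Matrix.mulVec, dotProduct, conjSign_neg_one, map_sum, map_mul]
    refine Finset.sum_congr rfl fun j _ => ?_
    rcases Int.units_eq_one_or (antiSign G K y) with hy | hy <;> simp [hy]

end VirtualAction

section Charges

variable {ι : Type*} [Fintype ι] [DecidableEq ι] {X : GL ι ℂ} {c : ℂ}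

theorem dotProduct_mulVec_eq_zero_of_commute {r s : ι → ℂ} {N : Matrix ι ι ℂ}
    (hX : X.val * Matrix.vecMulVec r s = Matrix.vecMulVec r s * X.val)
    (hN : X.val * N = c • (N * X.val)) (hc : c ≠ 1) : s ⬝ᵥ (N *ᵥ r) = 0 := by
  rw [← trace_vecMulVec_mul]
  set P := Matrix.vecMulVec r s
  have h_conj : X.val * (P * N) * X⁻¹.val = c • (P * N) := by
    rw [← mul_assoc, hX, mul_assoc P, hN, mul_smul_comm, smul_mul_assoc, mul_assoc, mul_assoc,
      Units.mul_inv, mul_one]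
  have h_trace := congrArg Matrix.trace h_conj
  rw [Matrix.trace_mul_comm, ← mul_assoc, Units.inv_mul, one_mul, Matrix.trace_smul,
    smul_eq_mul] at h_trace
  by_contra h_ne
  exact hc (mul_right_cancel₀ h_ne (h_trace.symm.trans (one_mul _).symm))

theorem mul_inv_eq_inv_smul {Y : GL ι ℂ} (hc : c ≠ 0)
    (h : X.val * Y.val = c • (Y.val * X.val)) :
    X.val * Y⁻¹.val = c⁻¹ • (Y⁻¹.val * X.val) := by
  rw [eq_inv_smul_iff₀ hc]
  calc c • (X.val * Y⁻¹.val) = Y⁻¹.val * (c • (Y.val * X.val)) * Y⁻¹.val := by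
        rw [mul_smul_comm, smul_mul_assoc, ← mul_assoc, Units.inv_mul, one_mul]
    _ = Y⁻¹.val * X.val := by
        rw [← h, mul_assoc, mul_assoc, Units.mul_inv, mul_one]

theorem leftRight_one_one {d χ : ℕ} (A : Tensor d χ) : leftRight 1 1 A = A :=
  opTransfer_injective <| LinearMap.ext fun O => by
    rw [opTransfer_leftRight, Matrix.conjTranspose_one, one_mul, mul_one]

theorem mul_opTransfer_eq {d χ : ℕ} {A : Tensor d χ} {u : Matrix (Fin d) (Fin d) ℂ}
    (hu : uᴴ * u = 1) {V : GL (Fin χ) ℂ} (hV : leftRight u u A = gaugeTransform 1 V A)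
    (R : Matrix (Fin d) (Fin d) ℂ) :
    V.val * opTransfer A R = opTransfer A (u * R * uᴴ) * V.val := by
  have h := opTransfer_gaugeTransform 1 V A (u * R * uᴴ)
  have h_cancel : uᴴ * (u * R * uᴴ) * u = R := by
    rw [mul_assoc u, ← mul_assoc uᴴ, hu, one_mul, mul_assoc, hu, mul_one]
  rw [← hV, opTransfer_leftRight, h_cancel, one_smul] at h
  rw [h, ← mul_assoc, ← mul_assoc, Units.mul_inv, one_mul]

end Charges

namespace SymmetricMPDO

variable {G K : Type*} [Group G] [Group K] (ρ : SymmetricMPDO G K)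

theorem conjTranspose_mul_onSite (p : G × K) : (ρ.onSite p).valᴴ * (ρ.onSite p).val = 1 :=
  Matrix.UnitaryGroup.star_mul_self _

theorem act_ketElt (g : G) : ρ.act (ketElt (g, 1)) = leftRight (ρ.U g).val 1 ρ.A := by
  have h_ket : ρ.onSite (g, 1) = ρ.U g := by simp [onSite]
  have h_bra : ρ.onSite (1, 1) = 1 := map_one ρ.onSite
  rw [ρ.act_eq_actOn, actOn, if_pos (antiSign_ketElt _), ketElt, SemidirectProduct.left_inl, h_ket,
    h_bra]
  rfl

theorem act_diagElt (p : G × K) :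
    ρ.act (diagElt p) = leftRight (ρ.onSite p).val (ρ.onSite p).val ρ.A := by
  rw [ρ.act_eq_actOn, actOn, if_pos (antiSign_diagElt _)]
  rfl

theorem act_hermElt : ρ.act (hermElt G K) = hermTensor ρ.A := by
  have h_one : ρ.onSite (1, 1) = 1 := map_one ρ.onSite
  rw [ρ.act_eq_actOn, actOn, antiSign_hermElt, if_neg (by decide), hermElt,
    SemidirectProduct.left_inr]
  change leftRight (ρ.onSite (1, 1)).val (ρ.onSite (1, 1)).val _ = _
  rw [h_one]
  exact leftRight_one_one _

theorem transfer_act_diagElt (p : G × K) : transfer (ρ.act (diagElt p)) = transfer ρ.A := by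
  rw [act_diagElt, ← opTransfer_one, opTransfer_leftRight, mul_one, ρ.conjTranspose_mul_onSite,
    opTransfer_one]

theorem transfer_act_hermElt :
    transfer (ρ.act (hermElt G K)) = (transfer ρ.A).map (starRingEnd ℂ) := by
  rw [act_hermElt, ← opTransfer_one, opTransfer_hermTensor, Matrix.conjTranspose_one,
    opTransfer_one]

namespace IsProjectiveAction

variable {ρ} {V : DoubledGroup G K → GL (Fin ρ.χ) ℂ}
  {ω : DoubledGroup G K → DoubledGroup G K → Circle} {l : ℝ} {r s r' s' : Fin ρ.χ → ℂ}

theorem exists_act_eq (h : ρ.IsProjectiveAction V ω) (x : DoubledGroup G K) :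
    ∃ κ : Circle, ρ.act x = gaugeTransform κ (V x) ρ.A := by
  obtain ⟨κ, hκ⟩ := h.gauge
  exact ⟨κ x, funext₂ (hκ x)⟩

theorem act_eq (h : ρ.IsProjectiveAction V ω) (hD : Dominant (transfer ρ.A) l r s)
    {x : DoubledGroup G K} (hD' : Dominant (transfer (ρ.act x)) l r' s') :
    ρ.act x = gaugeTransform 1 (V x) ρ.A := by
  obtain ⟨κ, hκ⟩ := h.exists_act_eq x
  have h_transfer := transfer_gaugeTransform κ (V x) ρ.A
  rw [← hκ] at h_transfer
  rw [hκ, hD.gauge_phase_eq_one hD' h_transfer]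

theorem transfer_act (h : ρ.IsProjectiveAction V ω) (hD : Dominant (transfer ρ.A) l r s)
    {x : DoubledGroup G K} (hD' : Dominant (transfer (ρ.act x)) l r' s') :
    transfer (ρ.act x) = (V x)⁻¹.val * transfer ρ.A * (V x).val := by
  rw [h.act_eq hD hD', transfer_gaugeTransform, one_smul]

theorem isProjectiveRep (h : ρ.IsProjectiveAction V ω) :
    IsProjectiveRep (antiSign G K) (virtualAct V) ω := by
  have h_mul (x y : DoubledGroup G K) (v : Fin ρ.χ → ℂ) :
      virtualAct V x (virtualAct V y v) = (ω x y : ℂ) • virtualAct V (x * y) v := by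
    rw [virtualAct, conjSign_virtualAct, Matrix.mulVec_mulVec, ← Units.val_mul, h.projective,
      Matrix.smul_mulVec]
    rfl
  refine ⟨virtualAct_smul V, h_mul, fun v => virtualAct_injective V 1 ?_⟩
  rw [h_mul, mul_one, virtualAct_smul, map_one, conjSign_one, RingHom.id_apply]

theorem isTwoCocycle (h : ρ.IsProjectiveAction V ω) : IsTwoCocycle (antiSign G K) ω :=
  have : NeZero ρ.χ := ⟨ρ.strongInjective.virtualDim_pos.ne'⟩
  h.isProjectiveRep.isTwoCocycle (v := 1) one_ne_zero

theorem mul_eq_slant_smul (h : ρ.IsProjectiveAction V ω) {x y : DoubledGroup G K}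
    (hx : antiSign G K x = 1) (hy : antiSign G K y = 1) (hxy : x * y = y * x) :
    (V y).val * (V x).val = (slant ω x y : ℂ) • ((V x).val * (V y).val) := by
  refine Matrix.ext_iff_mulVec.2 fun v => ?_
  simpa only [virtualAct_of_linear V hx, virtualAct_of_linear V hy, Matrix.mulVec_mulVec,
    Matrix.smul_mulVec] using h.isProjectiveRep.apply_apply_eq_slant_smul hxy v

section DiagonalGauge

variable (h : ρ.IsProjectiveAction V ω) (hD : Dominant (transfer ρ.A) l r s) (p : G × K)
include h hD

theorem leftRight_onSite : leftRight (ρ.onSite p).val (ρ.onSite p).val ρ.A =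
    gaugeTransform 1 (V (diagElt p)) ρ.A := by
  rw [← act_diagElt, h.act_eq hD (ρ.transfer_act_diagElt p ▸ hD)]

theorem diagElt_mul_vecMulVec : (V (diagElt p)).val * Matrix.vecMulVec r s =
    Matrix.vecMulVec r s * (V (diagElt p)).val := by
  refine hD.gauge_mul_vecMulVec hD ?_
  rw [← h.transfer_act hD (ρ.transfer_act_diagElt p ▸ hD), transfer_act_diagElt]

theorem exists_virtualAct_diagElt_eq_smul :
    ∃ c : ℂ, c ≠ 0 ∧ virtualAct V (diagElt p) r = c • r := by
  rw [virtualAct_of_linear V (antiSign_diagElt p)]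
  refine hD.exists_gauge_mulVec_eq_smul hD ?_
  rw [← h.transfer_act hD (ρ.transfer_act_diagElt p ▸ hD), transfer_act_diagElt]

theorem onSite_mul_liftOp {X : Matrix (Fin ρ.χ) (Fin ρ.χ) ℂ} {c : ℂ}
    (hX : (V (diagElt p)).val * X = c • (X * (V (diagElt p)).val)) :
    (ρ.onSite p).val * liftOp ρ.strongInjective.dualOp_injective X * (ρ.onSite p).valᴴ =
      c • liftOp ρ.strongInjective.dualOp_injective X := by
  rw [mul_liftOp_mul_conjTranspose _ (ρ.conjTranspose_mul_onSite p) (ρ.conjTranspose_mul_onSite p)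
    one_ne_zero (h.leftRight_onSite hD p), inv_one, one_smul, hX, smul_mul_assoc, mul_assoc,
    Units.mul_inv, mul_one, map_smul]

end DiagonalGauge

section HermitianGauge

variable (h : ρ.IsProjectiveAction V ω) (hD : Dominant (transfer ρ.A) l r s)
include h hD

theorem exists_virtualAct_hermElt_eq_smul :
    ∃ c : ℂ, c ≠ 0 ∧ virtualAct V (hermElt G K) r = c • r := by
  rw [virtualAct_hermElt]
  refine hD.exists_gauge_mulVec_eq_smul hD.map_star ?_
  rw [← h.transfer_act hD (ρ.transfer_act_hermElt ▸ hD.map_star), transfer_act_hermElt]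

theorem virtualAct_hermElt_opTransfer (R : Matrix (Fin ρ.d) (Fin ρ.d) ℂ) (v : Fin ρ.χ → ℂ) :
    virtualAct V (hermElt G K) (opTransfer ρ.A R *ᵥ v) =
      opTransfer ρ.A Rᴴ *ᵥ virtualAct V (hermElt G K) v := by
  have h_herm := opTransfer_hermTensor ρ.A Rᴴ
  rw [← act_hermElt, h.act_eq hD (ρ.transfer_act_hermElt ▸ hD.map_star), opTransfer_gaugeTransform,
    one_smul, Matrix.conjTranspose_conjTranspose] at h_herm
  rw [virtualAct_hermElt, virtualAct_hermElt, ← map_star_mulVec, ← h_herm, Matrix.mulVec_mulVec,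
    Matrix.mulVec_mulVec, ← mul_assoc, ← mul_assoc, Units.mul_inv, one_mul]

end HermitianGauge

section Positivity

variable (h : ρ.IsProjectiveAction V ω) (g : G)
include h

theorem opTransfer_mul_strong : ∃ κ : Circle, ∀ O, opTransfer ρ.A (O * (ρ.U g).val) =
    (κ : ℂ) • ((V (ketElt (g, 1)))⁻¹.val * opTransfer ρ.A O * (V (ketElt (g, 1))).val) := by
  obtain ⟨κ, hκ⟩ := h.exists_act_eq (ketElt (g, 1))
  refine ⟨κ, fun O => ?_⟩
  rw [← opTransfer_gaugeTransform, ← hκ, act_ketElt, opTransfer_leftRight,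
    Matrix.conjTranspose_one, one_mul]

theorem opTransfer_strong : ∃ κ : Circle, opTransfer ρ.A (ρ.U g).val =
    (κ : ℂ) • ((V (ketElt (g, 1)))⁻¹.val * transfer ρ.A * (V (ketElt (g, 1))).val) := by
  obtain ⟨κ, hκ⟩ := h.opTransfer_mul_strong g
  exact ⟨κ, by simpa only [one_mul, opTransfer_one] using hκ 1⟩

theorem exists_normalized_strong : ∃ u : Matrix (Fin ρ.d) (Fin ρ.d) ℂ, uᴴ * u = 1 ∧
    ∀ O, opTransfer ρ.A (O * u) =
      (V (ketElt (g, 1)))⁻¹.val * opTransfer ρ.A O * (V (ketElt (g, 1))).val := by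
  obtain ⟨κ, hκ⟩ := h.opTransfer_mul_strong g
  refine ⟨((κ⁻¹ : Circle) : ℂ) • (ρ.U g).val, ?_, fun O => ?_⟩
  · rw [Matrix.conjTranspose_smul, smul_mul_smul_comm, ← Matrix.star_eq_conjTranspose,
      Matrix.UnitaryGroup.star_mul_self, Complex.star_def, ← Circle.coe_inv_eq_conj,
      ← Circle.coe_mul, inv_mul_cancel, Circle.coe_one, one_smul]
  · rw [mul_smul_comm, map_smul, hκ, smul_smul, ← Circle.coe_mul, inv_mul_cancel, Circle.coe_one,
      one_smul]

variable (hD : Dominant (transfer ρ.A) l r s)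
include hD

/-- Up to the factor `l ^ 2`, this is the nonnegative string value of `Rᴴ * u` and `R`, for `u` the
normalized `U_g` and `R` such that `Rᴴ` has the transfer matrix `V_g`. -/
theorem dotProduct_ket_herm_ket_nonneg {e : ℂ} (he : e ≠ 0)
    (h_herm : virtualAct V (hermElt G K) r = e • r) :
    0 ≤ e⁻¹ * (s ⬝ᵥ virtualAct V (ketElt (g, 1)) (virtualAct V (hermElt G K)
      (virtualAct V (ketElt (g, 1)) r))) := by
  obtain ⟨u, hu, h_strong⟩ := h.exists_normalized_strong g
  set X := V (ketElt (g, 1))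
  set Q := liftOp ρ.strongInjective.dualOp_injective X.val
  have hQ : opTransfer ρ.A Q = X.val := opTransfer_liftOp _ _
  have h_left : opTransfer ρ.A (Qᴴᴴ * u) * X⁻¹.val = X⁻¹.val * X.val * (X.val * X⁻¹.val) := by
    rw [Matrix.conjTranspose_conjTranspose, h_strong, hQ, mul_assoc (_ * _)]
  have h_right : opTransfer ρ.A Qᴴ *ᵥ r =
      e⁻¹ • virtualAct V (hermElt G K) (virtualAct V (ketElt (g, 1)) r) := by
    rw [virtualAct_of_linear V (antiSign_ketElt _) r, ← hQ, h.virtualAct_hermElt_opTransfer hD,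
      h_herm, Matrix.mulVec_smul, smul_smul, inv_mul_cancel₀ he, one_smul]
  have h_transfer : opTransfer ρ.A u = X⁻¹.val * transfer ρ.A * X.val := by
    rw [← opTransfer_one, ← h_strong, one_mul]
  have h_nonneg := stringValue_nonneg ρ.posSemidef hD hu h_transfer Qᴴ
  rw [stringValue, h_left, Units.inv_mul, Units.mul_inv, one_mul, Matrix.one_mulVec, hD.dot,
    one_mul, ← Matrix.mulVec_mulVec, h_right, Matrix.mulVec_smul, dotProduct_smul, smul_eq_mul,
    ← virtualAct_of_linear V (antiSign_ketElt _)] at h_nonneg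
  have h_sq : (0 : ℂ) < (l : ℂ) ^ 2 := by exact_mod_cast pow_pos hD.pos 2
  simpa only [div_mul_cancel₀ _ h_sq.ne'] using mul_nonneg h_nonneg h_sq.le

theorem exists_ket_herm_ket_eq_smul : ∃ a : ℂ, a ≠ 0 ∧ virtualAct V (ketElt (g, 1))
    (virtualAct V (hermElt G K) (virtualAct V (ketElt (g, 1)) r)) = a • r := by
  have h_rep := h.isProjectiveRep
  obtain ⟨e, _, h_herm⟩ := h.exists_virtualAct_hermElt_eq_smul hD
  obtain ⟨c, _, h_diag⟩ := h.exists_virtualAct_diagElt_eq_smul hD (g, 1)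
  have h_elt : ketElt (g, 1) * (hermElt G K * ketElt (g, 1)) = hermElt G K * diagElt (g, 1) := by
    rw [← hermElt_ketElt_hermElt_ketElt, ← mul_assoc (hermElt G K) (hermElt G K),
      hermElt_mul_self, one_mul]
  have h_herm_diag := h_rep.map_mul (hermElt G K) (diagElt (g, 1)) r
  rw [h_diag, virtualAct_smul, h_herm, smul_smul, eq_comm,
    ← eq_inv_smul_iff₀ (Circle.coe_ne_zero _), ← h_elt] at h_herm_diag
  obtain ⟨a, h_eigen⟩ : ∃ a : ℂ, virtualAct V (ketElt (g, 1)) (virtualAct V (hermElt G K)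
      (virtualAct V (ketElt (g, 1)) r)) = a • r := by
    rw [h_rep.map_mul (hermElt G K), h_rep.map_smul_of_linear (antiSign_ketElt _), h_rep.map_mul,
      h_herm_diag, smul_smul, smul_smul, smul_smul]
    exact ⟨_, rfl⟩
  refine ⟨a, fun h_zero => ?_, h_eigen⟩
  rw [h_zero, zero_smul] at h_eigen
  exact h_rep.apply_ne_zero _ (h_rep.apply_ne_zero _ (h_rep.apply_ne_zero _ hD.right_ne_zero))
    h_eigen

theorem exists_pos_herm_ket_herm_ket : ∃ t : ℝ, 0 < t ∧
    virtualAct V (hermElt G K) (virtualAct V (ketElt (g, 1))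
      (virtualAct V (hermElt G K) (virtualAct V (ketElt (g, 1)) r))) = (t : ℂ) • r := by
  obtain ⟨e, he, h_herm⟩ := h.exists_virtualAct_hermElt_eq_smul hD
  obtain ⟨a, ha, h_ket⟩ := h.exists_ket_herm_ket_eq_smul g hD
  have h_nonneg := h.dotProduct_ket_herm_ket_nonneg g hD he h_herm
  rw [h_ket, dotProduct_smul, hD.dot, smul_eq_mul, mul_one] at h_nonneg
  have h_pos : 0 < e⁻¹ * a := h_nonneg.lt_of_ne (mul_ne_zero (inv_ne_zero he) ha).symm
  obtain ⟨t, ht⟩ : ∃ t : ℝ, (t : ℂ) = e⁻¹ * a := ⟨_, (Complex.eq_re_of_ofReal_le h_nonneg).symm⟩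
  rw [← ht, Complex.zero_lt_real] at h_pos
  refine ⟨‖e‖ ^ 2 * t, mul_pos (pow_pos (norm_pos_iff.2 he) 2) h_pos, ?_⟩
  rw [h_ket, virtualAct_smul, h_herm, smul_smul, antiSign_hermElt, conjSign_neg_one,
    ← (eq_inv_mul_iff_mul_eq₀ he).1 ht, map_mul, Complex.conj_ofReal, mul_right_comm,
    Complex.conj_mul']
  push_cast
  rfl

end Positivity

theorem positiveRep (h : ρ.IsProjectiveAction V ω) (hD : Dominant (transfer ρ.A) l r s) :
    PositiveRep (virtualAct V) ω r where
  toIsProjectiveRep := h.isProjectiveRep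
  ne_zero := hD.right_ne_zero
  weak_eigen k := h.exists_virtualAct_diagElt_eq_smul hD (1, k)
  herm_eigen := h.exists_virtualAct_hermElt_eq_smul hD
  pos g := h.exists_pos_herm_ket_herm_ket g hD

section StringOrder

variable {H : Type*} [Group H] {j : H →* G × K} {g : G} {α : H →* Circle}

theorem diagElt_mul_ketElt (h : ρ.IsProjectiveAction V ω) (hD : Dominant (transfer ρ.A) l r s)
    {p : G × K} (hgp : g * p.1 = p.1 * g) :
    (V (diagElt p)).val * (V (ketElt (g, 1))).val =
      (slant ω (ketElt (g, 1)) (ketElt p) : ℂ) •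
        ((V (ketElt (g, 1))).val * (V (diagElt p)).val) := by
  rw [← (h.positiveRep hD).slant_diagElt hgp]
  exact h.mul_eq_slant_smul rfl rfl (ketElt_diagElt_comm hgp)

theorem stringOrderVanishes (h : ρ.IsProjectiveAction V ω) (hg : ∀ p, g * (j p).1 = (j p).1 * g)
    (hα : ∃ p, (α p)⁻¹ ≠ slant ω (ketElt (g, 1)) (ketElt (j p))) :
    ρ.StringOrderVanishes (ρ.onSite.comp j) g α := by
  obtain ⟨l, r, s, hD⟩ := ρ.exists_dominant
  obtain ⟨p, hp⟩ := hα
  obtain ⟨κ, hκ⟩ := h.opTransfer_strong g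
  intro R' R _ hR
  have h_limit := stringLimit_norm_stringValue hD (Circle.norm_coe κ) hκ R' R
  suffices h_zero : s ⬝ᵥ (((V (ketElt (g, 1))).val * opTransfer ρ.A R) *ᵥ r) = 0 by
    rwa [stringValue, h_zero, mul_zero, zero_div, norm_zero] at h_limit
  have h_charge : (V (diagElt (j p))).val * opTransfer ρ.A R =
      (α p : ℂ) • (opTransfer ρ.A R * (V (diagElt (j p))).val) := by
    rw [mul_opTransfer_eq (ρ.conjTranspose_mul_onSite _) (h.leftRight_onSite hD _),
      ← smul_mul_assoc, ← map_smul]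
    exact congrArg (opTransfer ρ.A · * _) (hR p)
  refine dotProduct_mulVec_eq_zero_of_commute (h.diagElt_mul_vecMulVec hD (j p))
    (c := (slant ω (ketElt (g, 1)) (ketElt (j p)) * α p : Circle)) ?_ ?_
  · rw [← mul_assoc, h.diagElt_mul_ketElt hD (hg p), smul_mul_assoc, mul_assoc, h_charge,
      mul_smul_comm, smul_smul, Circle.coe_mul, mul_assoc]
  · exact fun h_one => hp (inv_eq_of_mul_eq_one_left (Circle.ext h_one))

theorem hasStringOrder (h : ρ.IsProjectiveAction V ω) (hg : ∀ p, g * (j p).1 = (j p).1 * g)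
    (hα : ∀ p, (α p)⁻¹ = slant ω (ketElt (g, 1)) (ketElt (j p))) :
    ρ.HasStringOrder (ρ.onSite.comp j) g α := by
  obtain ⟨l, r, s, hD⟩ := ρ.exists_dominant
  obtain ⟨κ, hκ⟩ := h.opTransfer_strong g
  set X := V (ketElt (g, 1))
  set hA := ρ.strongInjective.dualOp_injective
  have hX (p : H) : (V (diagElt (j p))).val * X.val =
      (α⁻¹ p : ℂ) • (X.val * (V (diagElt (j p))).val) := by
    rw [h.diagElt_mul_ketElt hD (hg p), ← hα p]
    rfl
  have hX_inv (p : H) : (V (diagElt (j p))).val * X⁻¹.val =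
      (α p : ℂ) • (X⁻¹.val * (V (diagElt (j p))).val) := by
    rw [mul_inv_eq_inv_smul (Circle.coe_ne_zero _) (hX p), MonoidHom.inv_apply, Circle.coe_inv,
      inv_inv]
  refine ⟨liftOp hA X.val, liftOp hA X⁻¹.val, fun p => h.onSite_mul_liftOp hD (j p) (hX p),
    fun p => h.onSite_mul_liftOp hD (j p) (hX_inv p), _, norm_pos_iff.2 ?_,
    stringLimit_norm_stringValue hD (Circle.norm_coe κ) hκ _ _⟩
  have hl : (l : ℂ) ≠ 0 := Complex.ofReal_ne_zero.2 hD.pos.ne'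
  rw [stringValue, opTransfer_liftOp, opTransfer_liftOp, Units.mul_inv, Matrix.one_mulVec, hD.dot,
    mul_one]
  exact div_ne_zero one_ne_zero (pow_ne_zero 2 hl)

end StringOrder

end IsProjectiveAction

variable {ρ} in
theorem StringOrderVanishes.not_hasStringOrder {H : Type*} [Group H]
    {u : H →* Matrix.unitaryGroup (Fin ρ.d) ℂ} {g : G} {α : H →* Circle}
    (h : ρ.StringOrderVanishes u g α) : ¬ ρ.HasStringOrder u g α := by
  rintro ⟨R', R, hR', hR, c, hc, h_limit⟩
  exact hc.ne' (h_limit.unique (h R' R hR' hR))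

end SymmetricMPDO

section SymmetricCocycle

noncomputable instance circleRootableBy : RootableBy Circle ℤ :=
  rootableByOfPowLeftSurj _ _ fun {n} hn z => by
    refine ⟨Circle.exp (Complex.arg z / n), ?_⟩
    have hn : (n : ℝ) ≠ 0 := Int.cast_ne_zero.2 hn
    simp only [← Circle.exp_zsmul, zsmul_eq_mul, mul_div_cancel₀ _ hn, Circle.exp_arg]

/-- The underlying set of the central extension of `G` by `M` defined by a 2-cocycle `η`: the pair
`(m, x)` stands for `m` times the chosen lift of `x`. -/
structure CentralExtension {G M : Type*} (η : G → G → M) where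
  phase : M
  base : G

variable {G M : Type*} [CommGroup M]

theorem IsTwoCocycle.one_left_eq [Group G] {η : G → G → M} (hη : IsTwoCocycle 1 η) (x : G) :
    η 1 x = η 1 1 := by
  simpa only [one_mul, mul_left_inj, eq_comm] using hη.mul_eq (x := 1) rfl 1 x

variable [CommGroup G] {η : G → G → M}

namespace CentralExtension

instance : Mul (CentralExtension η) where
  mul x y := ⟨x.phase * y.phase * η x.base y.base, x.base * y.base⟩

instance : One (CentralExtension η) where
  one := ⟨(η 1 1)⁻¹, 1⟩

instance : Inv (CentralExtension η) where
  inv x := ⟨x.phase⁻¹ * (η 1 1)⁻¹ * (η x.base⁻¹ x.base)⁻¹, x.base⁻¹⟩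

theorem mul_def (x y : CentralExtension η) :
    x * y = ⟨x.phase * y.phase * η x.base y.base, x.base * y.base⟩ :=
  rfl

theorem one_def : (1 : CentralExtension η) = ⟨(η 1 1)⁻¹, 1⟩ :=
  rfl

theorem inv_def (x : CentralExtension η) :
    x⁻¹ = ⟨x.phase⁻¹ * (η 1 1)⁻¹ * (η x.base⁻¹ x.base)⁻¹, x.base⁻¹⟩ :=
  rfl

/-- The extension of an abelian group by a symmetric 2-cocycle is an abelian group. -/
abbrev commGroup (hη : IsTwoCocycle 1 η) (h_symm : ∀ x y, η x y = η y x) :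
    CommGroup (CentralExtension η) :=
  have h_comm (x y : CentralExtension η) : x * y = y * x := by
    rw [mul_def, mul_def, h_symm, mul_comm x.phase, mul_comm x.base]
  have h_one_mul (x : CentralExtension η) : 1 * x = x := by
    simp only [mul_def, one_def, hη.one_left_eq, one_mul, mul_right_comm _ x.phase, inv_mul_cancel]
  { mul_assoc := fun x y z => by
      simp only [mul_def]
      rw [mul_assoc x.base, mul_right_comm (x.phase * y.phase), mul_assoc (_ * _) (η _ _),
        hη.mul_eq rfl]
      simp only [mul_assoc]
    one_mul := h_one_mul
    mul_one := fun x => (h_comm x 1).trans (h_one_mul x)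
    inv_mul_cancel := fun x => by
      simp only [mul_def, one_def, inv_def, inv_mul_cancel, mul_right_comm _ _ x.phase,
        inv_mul_cancel_right, one_mul]
    mul_comm := h_comm }

end CentralExtension

open CentralExtension in
/-- A divisible `M` is an injective abelian group, so the inclusion of `M` into the extension has a
retraction, whose values on the chosen lifts give the cochain. -/
theorem exists_coboundary_of_symmetric [RootableBy M ℤ] (hη : IsTwoCocycle 1 η)
    (h_symm : ∀ x y, η x y = η y x) :
    ∃ f : G → M, ∀ x y, η x y = f (x * y) / (f x * f y) := by
  let _ := commGroup hη h_symm
  let _ : DivisibleBy (Additive M) ℤ :=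
    divisibleByOfSMulRightSurj _ _ fun hn => RootableBy.surjective_pow M ℤ hn
  let incl : M →* CentralExtension η := MonoidHom.mk' (fun m => ⟨m * (η 1 1)⁻¹, 1⟩) fun m n => by
    simp only [mul_def, mul_one, mul_assoc, inv_mul_cancel, mul_left_comm (η 1 1)⁻¹]
  have h_inj : Function.Injective incl := fun m n hmn =>
    mul_right_cancel (congrArg phase hmn)
  obtain ⟨ψ, hψ⟩ := (Module.Baer.of_divisible (Additive M)).extension_property_addMonoidHom
    (MonoidHom.toAdditive incl) h_inj (AddMonoidHom.id (Additive M))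
  let retr : CentralExtension η →* M := MonoidHom.toAdditive.symm ψ
  have h_retr (m : M) : retr (incl m) = m := DFunLike.congr_fun hψ (Additive.ofMul m)
  have h_lift (x y : G) :
      (⟨1, x⟩ : CentralExtension η) * ⟨1, y⟩ = incl (η x y) * ⟨1, x * y⟩ := by
    change _ = (⟨η x y * (η 1 1)⁻¹, 1⟩ : CentralExtension η) * _
    simp only [mul_def, hη.one_left_eq, mul_one, one_mul, inv_mul_cancel_right]
  refine ⟨fun x => (retr ⟨1, x⟩)⁻¹, fun x y => ?_⟩
  have h_apply := congrArg retr (h_lift x y)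
  rw [map_mul, map_mul, h_retr] at h_apply
  rw [eq_div_iff_mul_eq', ← mul_inv, h_apply, mul_inv, mul_inv_cancel_left]

end SymmetricCocycle

section Classification

variable {G K : Type*} [Group G] [Group K]

namespace SymmetricMPDO

theorem onSite_comp_inl (ρ : SymmetricMPDO G K) : ρ.onSite.comp (MonoidHom.inl G K) = ρ.U :=
  MonoidHom.noncommCoprod_comp_inl _ _ _

theorem onSite_comp_inr (ρ : SymmetricMPDO G K) : ρ.onSite.comp (MonoidHom.inr G K) = ρ.W :=
  MonoidHom.noncommCoprod_comp_inr _ _ _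

namespace IsProjectiveAction

section Pairing

variable {ρ : SymmetricMPDO G K} {V : DoubledGroup G K → GL (Fin ρ.χ) ℂ}
  {ω : DoubledGroup G K → DoubledGroup G K → Circle}

theorem exists_pairing (h : ρ.IsProjectiveAction V ω) {G₁ H : Type*} [Group G₁] [Group H]
    (i : G₁ →* G) (j : H →* G × K) (hij : ∀ g p, i g * (j p).1 = (j p).1 * i g) :
    ∃ Ω : G₁ →* (H →* Circle),
      (∀ g p, Ω g p = slant ω (ketElt (i g, 1)) (ketElt (j p))) ∧
      ∀ (g : G₁) (α : H →* Circle),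
        (α⁻¹ = Ω g → ρ.HasStringOrder (ρ.onSite.comp j) (i g) α) ∧
        (α⁻¹ ≠ Ω g → ρ.StringOrderVanishes (ρ.onSite.comp j) (i g) α) := by
  have h_comm (g p) : ketElt (i g, (1 : K)) * ketElt (j p) = ketElt (j p) * ketElt (i g, 1) :=
    ketElt_comm_of_strong (hij g p)
  let Ω : G₁ →* (H →* Circle) := MonoidHom.mk'
    (fun g => MonoidHom.mk' (fun p => slant ω (ketElt (i g, 1)) (ketElt (j p))) fun p q => by
      rw [map_mul, ketElt_mul]
      exact h.isTwoCocycle.slant_mul_right rfl rfl (h_comm g p) (h_comm g q))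
    fun g g' => MonoidHom.ext fun p => by
      have h_mul : ketElt (i (g * g'), (1 : K)) = ketElt (i g, 1) * ketElt (i g', 1) := by
        rw [← ketElt_mul, Prod.mk_mul_mk, mul_one, map_mul]
      simp only [MonoidHom.mul_apply, MonoidHom.mk'_apply, h_mul]
      exact h.isTwoCocycle.slant_mul_left rfl rfl (h_comm g p) (h_comm g' p)
  refine ⟨Ω, fun _ _ => rfl, fun g α => ⟨fun hα => ?_, fun hα => ?_⟩⟩
  · exact h.hasStringOrder (hij g) fun p => DFunLike.congr_fun hα p
  · exact h.stringOrderVanishes (hij g) (DFunLike.ne_iff.1 hα)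

theorem hasStringOrder_iff (h : ρ.IsProjectiveAction V ω) {H : Type*} [Group H] {j : H →* G × K}
    {g : G} (hg : ∀ p, g * (j p).1 = (j p).1 * g) {α : H →* Circle} :
    ρ.HasStringOrder (ρ.onSite.comp j) g α ↔
      ∀ p, (α p)⁻¹ = slant ω (ketElt (g, 1)) (ketElt (j p)) := by
  refine ⟨fun h_order => ?_, h.hasStringOrder hg⟩
  by_contra! h_ne
  exact (h.stringOrderVanishes hg h_ne).not_hasStringOrder h_order

theorem isTwoCocycle_ketCocycle (h : ρ.IsProjectiveAction V ω) :
    IsTwoCocycle 1 (ketCocycle ω) := by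
  intro x y z
  have h_ket := h.isTwoCocycle.mul_eq (antiSign_ketElt (x, 1)) (ketElt (y, 1)) (ketElt (z, 1))
  simpa only [ketCocycle, ← ketElt_mul, Prod.mk_mul_mk, mul_one, MonoidHom.one_apply, Units.val_one,
    zpow_one] using h_ket

end Pairing

variable {ρ₁ ρ₂ : SymmetricMPDO G K} {V₁ : DoubledGroup G K → GL (Fin ρ₁.χ) ℂ}
  {V₂ : DoubledGroup G K → GL (Fin ρ₂.χ) ℂ} {ω₁ ω₂ : DoubledGroup G K → DoubledGroup G K → Circle}

theorem slant_eq_iff_hasStringOrder (h₁ : ρ₁.IsProjectiveAction V₁ ω₁)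
    (h₂ : ρ₂.IsProjectiveAction V₂ ω₂) {H : Type*} [Group H] (j : H →* G × K)
    (hj : ∀ g p, g * (j p).1 = (j p).1 * g) :
    (∀ g p, slant ω₁ (ketElt (g, 1)) (ketElt (j p)) = slant ω₂ (ketElt (g, 1)) (ketElt (j p))) ↔
      ∀ (g : G) (α : H →* Circle), ρ₁.HasStringOrder (ρ₁.onSite.comp j) g α ↔
        ρ₂.HasStringOrder (ρ₂.onSite.comp j) g α := by
  simp only [h₁.hasStringOrder_iff (hj _), h₂.hasStringOrder_iff (hj _)]
  refine ⟨fun h_eq g α => by simp only [h_eq], fun h_iff g p => ?_⟩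
  obtain ⟨Ω, hΩ, -⟩ := h₁.exists_pairing (MonoidHom.id G) j hj
  have h_slant := (h_iff g (Ω g)⁻¹).1 fun p => by
    rw [MonoidHom.inv_apply, inv_inv, hΩ, MonoidHom.id_apply]
  rw [← h_slant, MonoidHom.inv_apply, inv_inv, hΩ, MonoidHom.id_apply]

theorem cohomologous_iff_pairing_eq (h₁ : ρ₁.IsProjectiveAction V₁ ω₁)
    (h₂ : ρ₂.IsProjectiveAction V₂ ω₂)
    (h_ket : Cohomologous 1 (ketCocycle ω₁) (ketCocycle ω₂)) :
    Cohomologous (antiSign G K) ω₁ ω₂ ↔ ∀ (g : G) (k : K),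
      slant ω₁ (ketElt (g, 1)) (ketElt (1, k)) = slant ω₂ (ketElt (g, 1)) (ketElt (1, k)) := by
  refine ⟨fun h g k => h.slant_eq rfl rfl (ketElt_comm (by simp)), fun h => ?_⟩
  obtain ⟨_, _, _, hD₁⟩ := ρ₁.exists_dominant
  obtain ⟨_, _, _, hD₂⟩ := ρ₂.exists_dominant
  have h_pairing : pairing ω₁ = pairing ω₂ := funext₂ h
  have h_normal := cohomologous_normalCocycle_of_cohomologous (pairing ω₁) h_ket
  refine (h₁.positiveRep hD₁).cohomologous_normalCocycle.symm.trans (h_normal.trans ?_)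
  rw [h_pairing]
  exact (h₂.positiveRep hD₂).cohomologous_normalCocycle

theorem cohomologous_ketCocycle_of_slant_eq (hG : ∀ a b : G, a * b = b * a)
    (h₁ : ρ₁.IsProjectiveAction V₁ ω₁) (h₂ : ρ₂.IsProjectiveAction V₂ ω₂)
    (h_slant : ∀ g h : G,
      slant ω₁ (ketElt (g, 1)) (ketElt (h, 1)) = slant ω₂ (ketElt (g, 1)) (ketElt (h, 1))) :
    Cohomologous 1 (ketCocycle ω₁) (ketCocycle ω₂) := by
  let _ : CommGroup G := { ‹Group G› with mul_comm := hG }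
  have h_quot : IsTwoCocycle 1 fun x y => ketCocycle ω₂ x y / ketCocycle ω₁ x y := fun x y z => by
    simp only [MonoidHom.one_apply, Units.val_one, zpow_one, div_mul_div_comm,
      h₁.isTwoCocycle_ketCocycle.mul_eq rfl, h₂.isTwoCocycle_ketCocycle.mul_eq rfl]
  have h_symm (x y : G) : ketCocycle ω₂ x y / ketCocycle ω₁ x y =
      ketCocycle ω₂ y x / ketCocycle ω₁ y x := by
    have h_slant_xy : ketCocycle ω₁ y x / ketCocycle ω₁ x y =
      ketCocycle ω₂ y x / ketCocycle ω₂ x y := h_slant x y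
    rw [div_eq_div_iff_mul_eq_mul] at h_slant_xy ⊢
    rw [mul_comm (ketCocycle ω₂ x y), h_slant_xy]
  obtain ⟨f, hf⟩ := exists_coboundary_of_symmetric h_quot h_symm
  refine ⟨f, fun x y => ?_⟩
  rw [MonoidHom.one_apply, Units.val_one, zpow_one, ← hf, mul_div_cancel]

theorem cohomologous_iff_slant_eq (hG : ∀ a b : G, a * b = b * a)
    {ρ₁ ρ₂ : SymmetricMPDO G Unit}
    {V₁ : DoubledGroup G Unit → GL (Fin ρ₁.χ) ℂ} {V₂ : DoubledGroup G Unit → GL (Fin ρ₂.χ) ℂ}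
    {ω₁ ω₂ : DoubledGroup G Unit → DoubledGroup G Unit → Circle}
    (h₁ : ρ₁.IsProjectiveAction V₁ ω₁) (h₂ : ρ₂.IsProjectiveAction V₂ ω₂) :
    Cohomologous (antiSign G Unit) ω₁ ω₂ ↔ ∀ g h : G,
      slant ω₁ (ketElt (g, 1)) (ketElt (h, 1)) = slant ω₂ (ketElt (g, 1)) (ketElt (h, 1)) := by
  refine ⟨fun h g g' => h.slant_eq rfl rfl (ketElt_comm (by simp [hG])), fun h => ?_⟩
  refine (h₁.cohomologous_iff_pairing_eq h₂
    (cohomologous_ketCocycle_of_slant_eq hG h₁ h₂ h)).2 fun g _ => ?_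
  rw [show ketElt ((1 : G), _) = (1 : DoubledGroup G Unit) from ketElt_one,
    h₁.isTwoCocycle.slant_one_right rfl, h₂.isTwoCocycle.slant_one_right rfl]

end IsProjectiveAction

end SymmetricMPDO

end Classification

end MixedSPT

theorem mainTheorem5 {G K : Type*} [Group G] [Group K] :
    -- the projective representation and the cocycle that define the SPT phase exist
    (∀ ρ : MixedSPT.SymmetricMPDO G K, ∃ V ω, ρ.IsProjectiveAction V ω) ∧
    -- string order for a strong symmetry `G₁` and a symmetry `G'` that commutes with it
    (∀ (ρ : MixedSPT.SymmetricMPDO G K) V ω, ρ.IsProjectiveAction V ω →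
      ∀ (G₁ : Subgroup G) (G' : Subgroup (G × K)),
        (∀ g ∈ G₁, ∀ p ∈ G', g * p.1 = p.1 * g) →
        ∃ Ω : G₁ →* (G' →* Circle),
          (∀ (g : G₁) (p : G'),
            Ω g p = MixedSPT.slant ω (MixedSPT.ketElt (g, 1)) (MixedSPT.ketElt p)) ∧
          ∀ (g : G₁) (α : G' →* Circle),
            (α⁻¹ = Ω g → ρ.HasStringOrder (ρ.onSite.comp G'.subtype) (g : G) α) ∧
            (α⁻¹ ≠ Ω g → ρ.StringOrderVanishes (ρ.onSite.comp G'.subtype) (g : G) α)) ∧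
    -- strong Abelian symmetry
    ((∀ a b : G, a * b = b * a) →
      (∀ (ρ : MixedSPT.SymmetricMPDO G K) V ω, ρ.IsProjectiveAction V ω →
        ∃ Ω : G →* (G →* Circle),
          (∀ g h : G,
            Ω g h = MixedSPT.slant ω (MixedSPT.ketElt (g, 1)) (MixedSPT.ketElt (h, 1))) ∧
          ∀ (g : G) (α : G →* Circle),
            (α⁻¹ = Ω g → ρ.HasStringOrder ρ.U g α) ∧
            (α⁻¹ ≠ Ω g → ρ.StringOrderVanishes ρ.U g α)) ∧
      (∀ (ρ₁ ρ₂ : MixedSPT.SymmetricMPDO G Unit) V₁ ω₁ V₂ ω₂,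
        ρ₁.IsProjectiveAction V₁ ω₁ → ρ₂.IsProjectiveAction V₂ ω₂ →
        (MixedSPT.Cohomologous (MixedSPT.antiSign G Unit) ω₁ ω₂ ↔
          ∀ (g : G) (α : G →* Circle),
            ρ₁.HasStringOrder ρ₁.U g α ↔ ρ₂.HasStringOrder ρ₂.U g α))) ∧
    -- strong `G` and weak `K`, the component in `H¹(G, H¹(K, U(1))) = Hom(G, Hom(K, U(1)))`
    (∀ (ρ : MixedSPT.SymmetricMPDO G K) V ω, ρ.IsProjectiveAction V ω →
      ∃ Ω : G →* (K →* Circle),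
        (∀ (g : G) (k : K),
          Ω g k = MixedSPT.slant ω (MixedSPT.ketElt (g, 1)) (MixedSPT.ketElt (1, k))) ∧
        ∀ (g : G) (α : K →* Circle),
          (α⁻¹ = Ω g → ρ.HasStringOrder ρ.W g α) ∧
          (α⁻¹ ≠ Ω g → ρ.StringOrderVanishes ρ.W g α)) ∧
    (∀ (ρ₁ ρ₂ : MixedSPT.SymmetricMPDO G K) V₁ ω₁ V₂ ω₂,
      ρ₁.IsProjectiveAction V₁ ω₁ → ρ₂.IsProjectiveAction V₂ ω₂ →
      ((∀ (g : G) (k : K),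
          MixedSPT.slant ω₁ (MixedSPT.ketElt (g, 1)) (MixedSPT.ketElt (1, k)) =
            MixedSPT.slant ω₂ (MixedSPT.ketElt (g, 1)) (MixedSPT.ketElt (1, k))) ↔
        ∀ (g : G) (α : K →* Circle),
          ρ₁.HasStringOrder ρ₁.W g α ↔ ρ₂.HasStringOrder ρ₂.W g α) ∧
      (MixedSPT.Cohomologous 1 (MixedSPT.ketCocycle ω₁) (MixedSPT.ketCocycle ω₂) →
        (MixedSPT.Cohomologous (MixedSPT.antiSign G K) ω₁ ω₂ ↔
          ∀ (g : G) (α : K →* Circle),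
            ρ₁.HasStringOrder ρ₁.W g α ↔ ρ₂.HasStringOrder ρ₂.W g α))) := by
  refine ⟨fun ρ => ρ.exists_isProjectiveAction, ?_, ?_, ?_, ?_⟩
  · intro ρ V ω h G₁ G' hcomm
    exact h.exists_pairing G₁.subtype G'.subtype fun g p => hcomm g g.2 p p.2
  · intro hG
    refine ⟨fun ρ V ω h => ?_, fun ρ₁ ρ₂ V₁ ω₁ V₂ ω₂ h₁ h₂ => ?_⟩
    · have h_pairing := h.exists_pairing (MonoidHom.id G) (MonoidHom.inl G K) fun _ _ => hG _ _
      rwa [ρ.onSite_comp_inl] at h_pairing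
    · have h_order := h₁.slant_eq_iff_hasStringOrder h₂ (MonoidHom.inl G Unit) fun _ _ => hG _ _
      rw [ρ₁.onSite_comp_inl, ρ₂.onSite_comp_inl] at h_order
      exact (h₁.cohomologous_iff_slant_eq hG h₂).trans h_order
  · intro ρ V ω h
    have h_pairing := h.exists_pairing (MonoidHom.id G) (MonoidHom.inr G K) fun _ _ => by simp
    rwa [ρ.onSite_comp_inr] at h_pairing
  · intro ρ₁ ρ₂ V₁ ω₁ V₂ ω₂ h₁ h₂
    have h_order := h₁.slant_eq_iff_hasStringOrder h₂ (MonoidHom.inr G K) fun _ _ => by simp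
    rw [ρ₁.onSite_comp_inr, ρ₂.onSite_comp_inr] at h_order
    exact ⟨h_order, fun h_ket => (h₁.cohomologous_iff_pairing_eq h₂ h_ket).trans h_order⟩
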